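/- Let $\varepsilon,\mu>0$, $\delta=\sqrt{\mu/3}$ and $\mathbb R^+=[0,\infty)$. Let $R_1:L^2(\mathbb R^+)\to H^2(\mathbb R^+)$ be the inverse of $1-\frac{\mu}{3}\partial_x^2$ with homogeneous Neumann boundary condition, i.e. $v=R_1g$ is the solution in $H^2(\mathbb R^+)$ of $v-\frac{\mu}{3}\partial_x^2v=g$, $\partial_xv(0)=0$, and let $\underline R_1g=(R_1g)(0)$. Put $$\mathfrak f(\zeta,q)=\frac{1}{2\varepsilon}(h^2-1)+\varepsilon\frac{1}{h}q^2,\qquad h=1+\varepsilon\zeta .$$ **Theorem.** Let $f\in C^2(\mathbb R^+)$ with $1+\varepsilon f(0)\neq 0$, let $n\ge 1$, and let $(\zeta^0,q^0)\in H^n(\mathbb R^+)\times H^{n+1}(\mathbb R^+)$ be such that $\inf_{\mathbb R^+}(1+\varepsilon\zeta^0)>0$. Then there are $T>0$ and a unique solution $(\zeta,q)\in C^1([0,T];H^n(\mathbb R^+)\times H^{n+1}(\mathbb R^+))$ on $[0,T]$ of $$\begin{cases}\partial_t\zeta+\partial_xq=0,\\ \partial_tq+\partial_xR_1\mathfrak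 f(\zeta,q)=\underline{\mathcal Q}\,e^{-x/\delta},\end{cases}\qquad (\zeta,q)(0,\cdot)=(\zeta^0,q^0),$$ where, with $\underline q(t)=q(t,0)$, $$\underline{\mathcal Q}=\frac{\varepsilon}{\delta}\frac{\underline q^2}{1+\varepsilon f}+\delta\ddot f+\frac1\delta\Big(1+\frac{\varepsilon}{2}f\Big)f-\frac1\delta\underline R_1\mathfrak f(\zeta,q).$$ Here a solution is required to satisfy $\inf_{x}(1+\varepsilon\zeta(t,x))>0$ and $1+\varepsilon f(t)\neq0$ for all $t\in[0,T]$, so that the equations are meaningful. If moreover $\zeta^0(0)=f(0)$ and $-\partial_xq^0(0)=\dot f(0)$, then $\zeta(t,0)=f(t)$ for all $t\in[0,T]$. -/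

import Mathlib

open MeasureTheory Set Filter Topology
open scoped ContDiff

noncomputable section

namespace AbbottBoussinesq

/-- Lebesgue measure on the half-line `(0, ∞)`. -/
abbrev halfLine : Measure ℝ := volume.restrict (Ioi (0 : ℝ))

/-- The real space `L²(ℝ⁺)`. -/
abbrev L2 : Type := Lp ℝ 2 halfLine

/-- Smooth functions with compact support contained in the open half-line. -/
structure IsTestFunction (φ : ℝ → ℝ) : Prop where
  smooth : ContDiff ℝ ∞ φ
  compact : HasCompactSupport φ
  support : tsupport φ ⊆ Ioi 0

/-- `w` is the weak (distributional) derivative of `u` on `(0, ∞)`. -/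
def IsWeakDeriv (u w : L2) : Prop :=
  ∀ φ : ℝ → ℝ, IsTestFunction φ →
    ∫ x, u x * deriv φ x ∂halfLine = -∫ x, w x * φ x ∂halfLine

theorem integrable_mul_of_continuous (u : L2) {φ : ℝ → ℝ} (hc : Continuous φ)
    (hs : HasCompactSupport φ) : Integrable (fun x => u x * φ x) halfLine :=
  (Lp.memLp u).integrable_mul (q := 2) (hc.memLp_of_hasCompactSupport hs)

theorem integrable_mul_test (u : L2) {φ : ℝ → ℝ} (hφ : IsTestFunction φ) :
    Integrable (fun x => u x * φ x) halfLine :=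
  integrable_mul_of_continuous u hφ.smooth.continuous hφ.compact

theorem integrable_mul_deriv_test (u : L2) {φ : ℝ → ℝ} (hφ : IsTestFunction φ) :
    Integrable (fun x => u x * deriv φ x) halfLine :=
  integrable_mul_of_continuous u (hφ.smooth.continuous_deriv (by simp)) hφ.compact.deriv

theorem IsWeakDeriv.zero : IsWeakDeriv 0 0 := by
  intro φ _
  have h : ∀ ψ : ℝ → ℝ, ∫ x, (0 : L2) x * ψ x ∂halfLine = 0 := fun ψ => by
    rw [integral_congr_ae (g := fun _ => (0 : ℝ))]
    · simp
    · filter_upwards [Lp.coeFn_zero ℝ 2 halfLine] with x hx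
      rw [hx, Pi.zero_apply, zero_mul]
  rw [h, h, neg_zero]

theorem integral_add_mul (u v : L2) {ψ : ℝ → ℝ}
    (hu : Integrable (fun x => u x * ψ x) halfLine)
    (hv : Integrable (fun x => v x * ψ x) halfLine) :
    ∫ x, (u + v : L2) x * ψ x ∂halfLine =
      ∫ x, u x * ψ x ∂halfLine + ∫ x, v x * ψ x ∂halfLine := by
  rw [← integral_add hu hv]
  refine integral_congr_ae ?_
  filter_upwards [Lp.coeFn_add u v] with x hx
  rw [hx, Pi.add_apply, add_mul]

theorem integral_smul_mul (c : ℝ) (u : L2) (ψ : ℝ → ℝ) :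
    ∫ x, (c • u : L2) x * ψ x ∂halfLine = c * ∫ x, u x * ψ x ∂halfLine := by
  rw [← integral_const_mul]
  refine integral_congr_ae ?_
  filter_upwards [Lp.coeFn_smul c u] with x hx
  rw [hx, Pi.smul_apply, smul_eq_mul, mul_assoc]

theorem IsWeakDeriv.add {u v w z : L2} (h : IsWeakDeriv u w) (h' : IsWeakDeriv v z) :
    IsWeakDeriv (u + v) (w + z) := by
  intro φ hφ
  rw [integral_add_mul u v (integrable_mul_deriv_test u hφ) (integrable_mul_deriv_test v hφ),
    integral_add_mul w z (integrable_mul_test w hφ) (integrable_mul_test z hφ), h φ hφ, h' φ hφ,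
    neg_add]

theorem IsWeakDeriv.smul (c : ℝ) {u w : L2} (h : IsWeakDeriv u w) :
    IsWeakDeriv (c • u) (c • w) := by
  intro φ hφ
  rw [integral_smul_mul, integral_smul_mul, h φ hφ, mul_neg]

/-- The Sobolev space `Hⁿ(ℝ⁺)`. A function `u ∈ L²` whose weak derivatives of order at most `n` are
in `L²` is stored together with them, as `(u, ∂ₓu, …, ∂ₓⁿu)`. The norm inherited from `PiLp 2` is
the usual one, `‖u‖² = ∑_{k ≤ n} ‖∂ₓᵏu‖²_{L²}`. -/
def sobolevSubmodule (n : ℕ) : Submodule ℝ (PiLp 2 (fun _ : Fin (n + 1) => L2)) where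
  carrier := {U | ∀ k : Fin n, IsWeakDeriv (U k.castSucc) (U k.succ)}
  zero_mem' := fun _ => IsWeakDeriv.zero
  add_mem' := fun hU hV k => (hU k).add (hV k)
  smul_mem' := fun c _ hU k => (hU k).smul c

/-- `Hⁿ(ℝ⁺)` as a normed space. -/
abbrev Sobolev (n : ℕ) : Type := sobolevSubmodule n

/-- The function underlying an element of `Hⁿ(ℝ⁺)`. -/
def Sobolev.fn {n : ℕ} (u : Sobolev n) : ℝ → ℝ := (u.1 0 : L2)

/-- The weak derivative `∂ₓ : Hⁿ⁺¹(ℝ⁺) → Hⁿ(ℝ⁺)`. -/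
def Sobolev.dx {n : ℕ} (u : Sobolev (n + 1)) : Sobolev n :=
  ⟨WithLp.toLp 2 (fun k => u.1 k.succ), fun k => u.2 k.succ⟩

/-- `c` is the value at `x = 0` of a representative of `u` that is continuous on `[0, ∞)`. -/
def HasTrace (u : ℝ → ℝ) (c : ℝ) : Prop :=
  ∃ w : ℝ → ℝ, ContinuousOn w (Ici 0) ∧ w =ᵐ[halfLine] u ∧ w 0 = c

open Classical in
/-- The trace at `x = 0`: the value there of the continuous representative (which elements of
`Hⁿ(ℝ⁺)`, `n ≥ 1`, have; the value is `0` by convention if there is none). -/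
def trace (u : ℝ → ℝ) : ℝ :=
  if h : ∃ c, HasTrace u c then h.choose else 0

/-- `v ∈ H²(ℝ⁺)` solves `(1 - (μ/3) ∂ₓ²) v = g` in `L²(ℝ⁺)` with `∂ₓv(0) = 0`. -/
def SolvesNeumann (μ : ℝ) (g : ℝ → ℝ) (v : Sobolev 2) : Prop :=
  (∀ᵐ x ∂halfLine, v.fn x - μ / 3 * v.dx.dx.fn x = g x) ∧ trace v.dx.fn = 0

open Classical in
/-- `R₁ : L²(ℝ⁺) → H²(ℝ⁺)`, the inverse of `1 - (μ/3) ∂ₓ²` with homogeneous Neumann condition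
(extended by `0` to functions that are not square integrable). -/
def R₁ (μ : ℝ) (g : ℝ → ℝ) : Sobolev 2 :=
  if h : ∃ v, SolvesNeumann μ g v then h.choose else 0

/-- The boundary operator `g ↦ (R₁ g)(0)`. -/
def R₁bdry (μ : ℝ) (g : ℝ → ℝ) : ℝ := trace (R₁ μ g).fn

/-- The flux `(h² - 1) / (2ε) + ε q² / h` with `h = 1 + ε ζ`. -/
def flux (ε : ℝ) (ζ q : ℝ → ℝ) : ℝ → ℝ := fun x =>
  1 / (2 * ε) * ((1 + ε * ζ x) ^ 2 - 1) + ε * (1 / (1 + ε * ζ x)) * q x ^ 2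

/-- The width of the dispersive boundary layer. -/
def δ (μ : ℝ) : ℝ := √(μ / 3)

/-- The amplitude of the dispersive boundary layer; `q₀`, `f₀`, `f₂` stand for the values of the
trace of `q`, of `f` and of the second derivative of `f`. -/
def Q (ε μ q₀ f₀ f₂ : ℝ) (ζ q : ℝ → ℝ) : ℝ :=
  ε / δ μ * (q₀ ^ 2 / (1 + ε * f₀)) + δ μ * f₂ + 1 / δ μ * (1 + ε / 2 * f₀) * f₀
    - 1 / δ μ * R₁bdry μ (flux ε ζ q)

/-- `u` takes values with `inf (1 + ε u) > 0` (for a continuous `u` the infimum over `x > 0` is the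
essential infimum). -/
def PositiveDepth (ε : ℝ) (u : ℝ → ℝ) : Prop :=
  ∃ c > 0, ∀ᵐ x ∂halfLine, c ≤ 1 + ε * u x

/-- `(ζ, q) ∈ C¹([0,T]; Hⁿ × Hⁿ⁺¹)` solves the reformulated Abbott–Boussinesq system with initial
data `(ζ⁰, q⁰)`. The fields `depth` and `depth_bdry` say that the quotients in the equations are
meaningful. -/
structure IsSolution (ε μ : ℝ) (f : ℝ → ℝ) {n : ℕ} (ζ0 : Sobolev n) (q0 : Sobolev (n + 1))
    (T : ℝ) (ζ : ℝ → Sobolev n) (q : ℝ → Sobolev (n + 1)) : Prop where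
  contDiff_ζ : ContDiffOn ℝ 1 ζ (Icc 0 T)
  contDiff_q : ContDiffOn ℝ 1 q (Icc 0 T)
  init_ζ : ζ 0 = ζ0
  init_q : q 0 = q0
  depth : ∀ t ∈ Icc 0 T, PositiveDepth ε (ζ t).fn
  depth_bdry : ∀ t ∈ Icc 0 T, 1 + ε * f t ≠ 0
  mass : ∀ t ∈ Icc 0 T, derivWithin ζ (Icc 0 T) t + (q t).dx = 0
  momentum : ∀ t ∈ Icc 0 T, ∀ᵐ x ∂halfLine,
    (derivWithin q (Icc 0 T) t).fn x + (R₁ μ (flux ε (ζ t).fn (q t).fn)).dx.fn x =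
      Q ε μ (trace (q t).fn) (f t) (iteratedDerivWithin 2 f (Ici 0) t) (ζ t).fn (q t).fn
        * Real.exp (-x / δ μ)

end AbbottBoussinesq

end

/-!
The system is an ordinary differential equation in `Hⁿ(ℝ⁺) × Hⁿ⁺¹(ℝ⁺)`, `n ≥ 1`: the operator
`∂ₓ R₁` gains one derivative, and `Hⁿ` is an algebra, stable under `ζ ↦ 1 / (1 + ε ζ) - 1` as long
as `1 + ε ζ` is bounded away from `0`. So the right-hand side `Sobolev.evolution` is locally
Lipschitz on the open set of pairs `(ζ, q)` of positive depth, and the Picard-Lindelöf theorem gives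
existence, while uniqueness follows from local uniqueness by continuous induction in time
(`exists_solution_of_locallyLipschitz`, `eqOn_of_locallyLipschitz`).

The facts on Sobolev spaces rest on one characterization: `w ∈ L²` is the weak derivative of
`u ∈ L²` if and only if `u` has a representative that is absolutely continuous on bounded intervals
with almost everywhere derivative `w` (`IsWeakDeriv.exists_isLocAC`, `IsLocAC.isWeakDeriv`). It
reduces the Leibniz rule, the rule for reciprocals, integration by parts on the half-line and the
bound `sup |u| ≤ ‖u‖_{H¹}` to the calculus of absolutely continuous functions; statements in `Hⁿ`
then follow by induction on `n`. The operator `R₁` comes from the Lax-Milgram theorem in `H¹`, its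
boundary condition being the natural one, and it maps `Hⁿ` to `Hⁿ⁺²` because
`∂ₓ²v = (3 / μ) (v - g)` (`Sobolev.exists_neumann`).

For the last claim put `y(t) = ζ(t, 0) - f(t)`. Then `ẏ = -∂ₓq(t, 0) - ḟ`, and the amplitude of the
boundary layer is such that the nonlocal terms cancel in the second derivative: `ÿ = -k(t) y` with
`k` continuous (`Sobolev.traceL_dx_evolution`). Under the compatibility conditions `y` and `ẏ`
vanish at `t = 0`, hence `y = 0` by Grönwall's lemma (`IsSolution.trace_eq`).
-/

namespace AbbottBoussinesq

noncomputable section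

/-! ### Absolutely continuous functions on the half-line -/

/-- `r` is locally absolutely continuous on `[0, ∞)` with almost everywhere derivative `w`. -/
structure IsLocAC (r w : ℝ → ℝ) : Prop where
  ac : ∀ b, 0 ≤ b → AbsolutelyContinuousOnInterval r 0 b
  hasDerivAt : ∀ᵐ x ∂halfLine, HasDerivAt r (w x) x

namespace IsLocAC

variable {r s w z : ℝ → ℝ}

theorem congr_right (h : IsLocAC r w) (hw : w =ᵐ[halfLine] z) : IsLocAC r z := by
  refine ⟨h.ac, ?_⟩
  filter_upwards [h.hasDerivAt, hw] with x hx hx'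
  rwa [← hx']

theorem continuousOn (h : IsLocAC r w) : ContinuousOn r (Ici 0) := by
  intro x hx
  have hx : (0 : ℝ) ≤ x := hx
  have h1 := (h.ac (x + 1) (by linarith)).continuousOn
  rw [uIcc_of_le (by linarith)] at h1
  refine (h1 x ⟨hx, by linarith⟩).mono_of_mem_nhdsWithin ?_
  rw [← Ici_inter_Iic]
  exact inter_mem_nhdsWithin _ (Iic_mem_nhds (by linarith))

theorem ae_eq_deriv (h : IsLocAC r w) {b : ℝ} :
    ∀ᵐ x ∂volume, x ∈ Ioc 0 b → deriv r x = w x := by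
  have := (ae_restrict_iff' measurableSet_Ioi).1 h.hasDerivAt
  filter_upwards [this] with x hx hxb
  exact (hx hxb.1).deriv

theorem intervalIntegrable (h : IsLocAC r w) {b : ℝ} (hb : 0 ≤ b) :
    IntervalIntegrable w volume 0 b := by
  refine (h.ac b hb).intervalIntegrable_deriv.congr_ae ?_
  rw [uIoc_of_le hb]
  exact (ae_restrict_iff' measurableSet_Ioc).2 h.ae_eq_deriv

theorem integral_eq (h : IsLocAC r w) {b : ℝ} (hb : 0 ≤ b) :
    ∫ x in 0..b, w x = r b - r 0 := by
  rw [← (h.ac b hb).integral_deriv_eq_sub]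
  refine intervalIntegral.integral_congr_ae ?_
  rw [uIoc_of_le hb]
  filter_upwards [h.ae_eq_deriv (b := b)] with x hx hxb
  exact (hx hxb).symm

theorem add (h : IsLocAC r w) (h' : IsLocAC s z) :
    IsLocAC (fun x => r x + s x) (fun x => w x + z x) := by
  refine ⟨fun b hb => (h.ac b hb).add (h'.ac b hb), ?_⟩
  filter_upwards [h.hasDerivAt, h'.hasDerivAt] with x hx hx'
  exact hx.add hx'

theorem const_mul (c : ℝ) (h : IsLocAC r w) :
    IsLocAC (fun x => c * r x) (fun x => c * w x) := by
  refine ⟨fun b hb => (h.ac b hb).const_mul c, ?_⟩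
  filter_upwards [h.hasDerivAt] with x hx
  exact hx.const_mul c

theorem mul (h : IsLocAC r w) (h' : IsLocAC s z) :
    IsLocAC (fun x => r x * s x) (fun x => w x * s x + r x * z x) := by
  refine ⟨fun b hb => (h.ac b hb).mul (h'.ac b hb), ?_⟩
  filter_upwards [h.hasDerivAt, h'.hasDerivAt] with x hx hx'
  exact hx.mul hx'

theorem of_contDiff {φ : ℝ → ℝ} (h : ContDiff ℝ 1 φ) : IsLocAC φ (deriv φ) :=
  ⟨fun _ _ => h.contDiffOn.absolutelyContinuousOnInterval,
    Eventually.of_forall fun x => (h.differentiable (by simp) x).hasDerivAt⟩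

theorem const (c : ℝ) : IsLocAC (fun _ => c) (fun _ => 0) :=
  ⟨fun _ _ => contDiffOn_const.absolutelyContinuousOnInterval,
    Eventually.of_forall fun x => hasDerivAt_const x c⟩

theorem integral {w : ℝ → ℝ} (h : ∀ b, 0 ≤ b → IntervalIntegrable w volume 0 b) :
    IsLocAC (fun x => ∫ t in 0..x, w t) w := by
  refine ⟨fun b hb => (h b hb).absolutelyContinuousOnInterval_intervalIntegral left_mem_uIcc, ?_⟩
  have h1 : ∀ n : ℕ, ∀ᵐ x ∂volume, x ∈ uIcc (0 : ℝ) n →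
      ∀ c ∈ uIcc (0 : ℝ) n, HasDerivAt (fun x => ∫ t in c..x, w t) (w x) x := fun n =>
    (h n n.cast_nonneg).ae_hasDerivAt_integral
  refine (ae_restrict_iff' measurableSet_Ioi).2 ?_
  filter_upwards [ae_all_iff.2 h1] with x hx hx0
  obtain ⟨n, hn⟩ := exists_nat_ge x
  refine hx n ?_ 0 left_mem_uIcc
  rw [uIcc_of_le n.cast_nonneg]
  exact ⟨le_of_lt hx0, hn⟩

/-- The reciprocal of a locally absolutely continuous function bounded away from zero. -/
theorem inv (h : IsLocAC r w) {c : ℝ} (hc : 0 < c) (hr : ∀ x, 0 ≤ x → c ≤ r x) :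
    IsLocAC (fun x => (r x)⁻¹) (fun x => -w x / r x ^ 2) := by
  constructor
  · intro b hb
    have hac := h.ac b hb
    rw [absolutelyContinuousOnInterval_iff] at hac ⊢
    intro e he
    obtain ⟨d, hd, H⟩ := hac (c ^ 2 * e) (by positivity)
    refine ⟨d, hd, fun E hE hEd => ?_⟩
    have key : ∀ i ∈ Finset.range E.1, c ^ 2 * dist (r (E.2 i).1)⁻¹ (r (E.2 i).2)⁻¹ ≤
        dist (r (E.2 i).1) (r (E.2 i).2) := by
      intro i hi
      have hm := hE.1 i hi
      rw [uIcc_of_le hb] at hm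
      have h1 := hr _ hm.1.1
      have h2 := hr _ hm.2.1
      have p1 : 0 < r (E.2 i).1 := hc.trans_le h1
      have p2 : 0 < r (E.2 i).2 := hc.trans_le h2
      rw [Real.dist_eq, Real.dist_eq, inv_sub_inv p1.ne' p2.ne', abs_div,
        abs_of_pos (mul_pos p1 p2), abs_sub_comm, ← mul_div_assoc, div_le_iff₀ (mul_pos p1 p2),
        mul_comm]
      refine mul_le_mul_of_nonneg_left ?_ (abs_nonneg _)
      rw [sq]
      exact mul_le_mul h1 h2 hc.le p1.le
    have h3 := (Finset.sum_le_sum key).trans_lt (H E hE hEd)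
    rw [← Finset.mul_sum] at h3
    exact lt_of_mul_lt_mul_left h3 (by positivity)
  · filter_upwards [h.hasDerivAt, ae_restrict_mem measurableSet_Ioi] with x hx hx0
    exact hx.inv (hc.trans_le (hr x (le_of_lt hx0))).ne'

/-- An integrable function with integrable derivative tends to `0` at infinity, whence the
fundamental theorem of calculus on the whole half-line. -/
theorem integral_halfLine (h : IsLocAC r w) (hr : Integrable r halfLine)
    (hw : Integrable w halfLine) : ∫ x, w x ∂halfLine = -r 0 := by
  have h1 : Tendsto (fun b => ∫ x in 0..b, w x) atTop (𝓝 (∫ x, w x ∂halfLine)) :=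
    intervalIntegral_tendsto_integral_Ioi 0 hw tendsto_id
  have h2 : Tendsto r atTop (𝓝 (r 0 + ∫ x, w x ∂halfLine)) := by
    refine (h1.const_add (r 0)).congr' ?_
    filter_upwards [eventually_ge_atTop 0] with b hb
    rw [h.integral_eq hb]
    ring
  have h3 : r 0 + ∫ x, w x ∂halfLine = 0 := by
    refine IntegrableAtFilter.eq_zero_of_tendsto (μ := volume) ?_ ?_ h2
    · exact ⟨Ioi 0, Ioi_mem_atTop 0, hr⟩
    · intro t ht
      rcases mem_atTop_sets.1 ht with ⟨b, hb⟩
      rw [← top_le_iff, ← Real.volume_Ici (a := b)]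
      exact measure_mono hb
  linarith

/-- The bound `|r(x)| ≤ ∫ |w|`, from `r(x) = -∫ₓ^∞ w`. -/
theorem abs_le_integral (h : IsLocAC r w) (hr : Integrable r halfLine)
    (hw : Integrable w halfLine) {x : ℝ} (hx : 0 ≤ x) : |r x| ≤ ∫ x, |w x| ∂halfLine := by
  have h1 := h.integral_halfLine hr hw
  have h2 := h.integral_eq hx
  have h3 := intervalIntegral.integral_Ioi_sub_Ioi (μ := volume) hw hx
  have h4 : r x = -∫ t in Ioi x, w t := by linarith
  rw [h4, abs_neg]
  refine abs_integral_le_integral_abs.trans ?_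
  exact setIntegral_mono_set hw.abs (Eventually.of_forall fun _ => abs_nonneg _)
    (Ioi_subset_Ioi hx).eventuallyLE

end IsLocAC

/-! ### Weak derivatives and absolutely continuous representatives -/

theorem integrable_of_eq_zero_of_lt {g : ℝ → ℝ} {b : ℝ}
    (hg : IntegrableOn g (Ioc 0 b)) (h0 : ∀ x, b < x → g x = 0) : Integrable g halfLine := by
  refine IntegrableOn.of_forall_sdiff_eq_zero hg measurableSet_Ioi fun x hx => h0 x ?_
  by_contra hxb
  exact hx.2 ⟨hx.1, not_lt.1 hxb⟩

namespace IsTestFunction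

variable {φ : ℝ → ℝ}

theorem eq_zero_of_nonpos (h : IsTestFunction φ) {x : ℝ} (hx : x ≤ 0) : φ x = 0 := by
  by_contra hne
  exact absurd (h.support (subset_tsupport _ hne)) (not_lt.2 hx)

theorem exists_bounds (h : IsTestFunction φ) :
    ∃ a b, 0 < a ∧ a ≤ b ∧ ∀ x, φ x ≠ 0 → x ∈ Icc a b := by
  rcases (tsupport φ).eq_empty_or_nonempty with he | hne
  · refine ⟨1, 1, one_pos, le_rfl, fun x hx => ?_⟩
    have := subset_tsupport φ hx
    rw [he] at this
    exact this.elim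
  · obtain ⟨a, ha, hamin⟩ := h.compact.isCompact.exists_isLeast hne
    obtain ⟨b, hb, hbmax⟩ := h.compact.isCompact.exists_isGreatest hne
    exact ⟨a, b, h.support ha, hamin hb, fun x hx =>
      ⟨hamin (subset_tsupport _ hx), hbmax (subset_tsupport _ hx)⟩⟩

theorem isTestFunction_deriv (h : IsTestFunction φ) : IsTestFunction (deriv φ) where
  smooth := by
    have := h.smooth
    exact (contDiff_infty_iff_deriv.1 this).2
  compact := h.compact.deriv
  support := (closure_minimal support_deriv_subset (isClosed_tsupport φ)).trans h.support

theorem integrable_mul (h : IsTestFunction φ) {g : ℝ → ℝ}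
    (hg : ∀ b, 0 ≤ b → IntervalIntegrable g volume 0 b) :
    Integrable (fun x => g x * φ x) halfLine := by
  obtain ⟨a, b, ha, hab, hφ⟩ := h.exists_bounds
  have hb : 0 ≤ b := ha.le.trans hab
  refine integrable_of_eq_zero_of_lt (b := b) ?_ fun x hx => ?_
  · exact (intervalIntegrable_iff_integrableOn_Ioc_of_le hb).1
      ((hg b hb).mul_continuousOn h.smooth.continuous.continuousOn)
  · have : φ x = 0 := by
      by_contra hne
      exact absurd (hφ x hne).2 (not_le.2 hx)
    rw [this, mul_zero]

end IsTestFunction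

/-- Integration by parts against a test function. -/
theorem IsLocAC.integral_mul_deriv {r w φ : ℝ → ℝ} (h : IsLocAC r w) (hφ : IsTestFunction φ) :
    ∫ x, r x * deriv φ x ∂halfLine = -∫ x, w x * φ x ∂halfLine := by
  have hr : ∀ b, 0 ≤ b → IntervalIntegrable r volume 0 b := fun b hb =>
    ((h.continuousOn).mono (by rw [uIcc_of_le hb]; exact Icc_subset_Ici_self)).intervalIntegrable
  have i1 := hφ.integrable_mul hr
  have i2 := hφ.isTestFunction_deriv.integrable_mul hr
  have i3 := hφ.integrable_mul fun b hb => h.intervalIntegrable hb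
  have h1 := (h.mul (of_contDiff (hφ.smooth.of_le (by simp)))).integral_halfLine i1 (i3.add i2)
  rw [integral_add i3 i2, hφ.eq_zero_of_nonpos le_rfl, mul_zero, neg_zero] at h1
  linarith

theorem exists_isTestFunction_integral_eq_one :
    ∃ ψ : ℝ → ℝ, IsTestFunction ψ ∧ ∫ x, ψ x ∂halfLine = 1 := by
  let B : ContDiffBump (1 : ℝ) := ⟨1 / 4, 1 / 2, by norm_num, by norm_num⟩
  have hs : tsupport (B.normed volume) ⊆ Ioi 0 := by
    rw [B.tsupport_normed_eq]
    intro x hx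
    rw [Metric.mem_closedBall, Real.dist_eq, abs_le] at hx
    have : B.rOut = 1 / 2 := rfl
    rw [this] at hx
    exact show (0 : ℝ) < x by linarith [hx.1]
  refine ⟨B.normed volume, ⟨B.contDiff_normed, B.hasCompactSupport_normed, hs⟩, ?_⟩
  rw [setIntegral_eq_integral_of_forall_compl_eq_zero, B.integral_normed]
  intro x hx
  by_contra hne
  exact hx (hs (subset_tsupport _ hne))

/-- A test function of zero mean is the derivative of a test function. -/
theorem IsTestFunction.exists_deriv_eq {φ : ℝ → ℝ} (h : IsTestFunction φ)
    (h0 : ∫ x, φ x ∂halfLine = 0) : ∃ Φ, IsTestFunction Φ ∧ deriv Φ = φ := by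
  obtain ⟨a, b, ha, hab, hφ⟩ := h.exists_bounds
  have hz : ∀ x, x < a ∨ b < x → φ x = 0 := by
    intro x hx
    by_contra hne
    rcases hx with hx | hx
    · exact absurd (hφ x hne).1 (not_le.2 hx)
    · exact absurd (hφ x hne).2 (not_le.2 hx)
  have hc := h.smooth.continuous
  have hd : ∀ x, HasDerivAt (fun x => ∫ t in 0..x, φ t) (φ x) x := fun x =>
    intervalIntegral.integral_hasDerivAt_right (hc.intervalIntegrable _ _)
      hc.stronglyMeasurable.stronglyMeasurableAtFilter hc.continuousAt
  have hd' : deriv (fun x => ∫ t in 0..x, φ t) = φ := funext fun x => (hd x).deriv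
  have hs : Function.support (fun x => ∫ t in 0..x, φ t) ⊆ Icc a b := by
    intro x hx
    by_contra hxm
    apply hx
    rw [mem_Icc, not_and_or, not_le, not_le] at hxm
    rcases hxm with hxa | hxb
    · refine intervalIntegral.integral_zero_ae (Eventually.of_forall fun t ht => hz t (Or.inl ?_))
      exact ht.2.trans_lt (max_lt ha hxa)
    · have hx0 : 0 ≤ x := ha.le.trans (hab.trans hxb.le)
      have hi : IntegrableOn φ (Ioi 0) := (hc.integrable_of_hasCompactSupport h.compact).integrableOn
      have h1 := intervalIntegral.integral_Ioi_sub_Ioi hi hx0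
      have h2 : ∫ t in Ioi x, φ t = 0 :=
        setIntegral_eq_zero_of_forall_eq_zero fun t ht => hz t (Or.inr (hxb.trans ht))
      rw [h0, h2, sub_zero] at h1
      exact h1.symm
  have hts : tsupport (fun x => ∫ t in 0..x, φ t) ⊆ Icc a b :=
    closure_minimal hs isClosed_Icc
  refine ⟨_, ⟨?_, ?_, ?_⟩, hd'⟩
  · rw [contDiff_infty_iff_deriv, hd']
    exact ⟨fun x => (hd x).differentiableAt, h.smooth⟩
  · exact HasCompactSupport.of_support_subset_isCompact isCompact_Icc hs
  · exact hts.trans fun x hx => ha.trans_le hx.1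

theorem L2.intervalIntegrable (u : L2) {b : ℝ} (hb : 0 ≤ b) : IntervalIntegrable u volume 0 b := by
  rw [intervalIntegrable_iff_integrableOn_Ioc_of_le hb]
  have h1 : MemLp u 2 (volume.restrict (Ioc 0 b)) :=
    (Lp.memLp u).mono_measure (Measure.restrict_mono Ioc_subset_Ioi_self le_rfl)
  exact h1.integrable (by norm_num)

/-- The du Bois-Reymond lemma: a function whose weak derivative vanishes is constant. -/
theorem ae_eq_const_of_integral_mul_deriv_eq_zero {v : ℝ → ℝ}
    (hv : ∀ b, 0 ≤ b → IntervalIntegrable v volume 0 b)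
    (h : ∀ φ, IsTestFunction φ → ∫ x, v x * deriv φ x ∂halfLine = 0) :
    ∃ c, v =ᵐ[halfLine] fun _ => c := by
  obtain ⟨ψ, hψ, hψ1⟩ := exists_isTestFunction_integral_eq_one
  set c := ∫ x, v x * ψ x ∂halfLine with hcdef
  refine ⟨c, ?_⟩
  have hl : LocallyIntegrableOn (fun x => v x - c) (Ioi 0) volume := by
    rw [locallyIntegrableOn_iff isOpen_Ioi.isLocallyClosed]
    intro k hk hkc
    obtain ⟨b, hb⟩ := hkc.bddAbove
    have hb' : k ⊆ Ioc 0 (max b 0) := fun x hx => ⟨hk hx, (hb hx).trans (le_max_left _ _)⟩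
    have := ((hv _ (le_max_right b 0)).sub
      (intervalIntegrable_const (c := c) (μ := volume)))
    exact ((intervalIntegrable_iff_integrableOn_Ioc_of_le (le_max_right b 0)).1 this).mono_set hb'
  have key := isOpen_Ioi.ae_eq_zero_of_integral_contDiff_smul_eq_zero hl ?_
  · refine (ae_restrict_iff' measurableSet_Ioi).2 ?_
    filter_upwards [key] with x hx hx0
    exact sub_eq_zero.1 (hx hx0)
  intro φ h1 h2 h3
  have hφ : IsTestFunction φ := ⟨h1, h2, h3⟩
  set m := ∫ x, φ x ∂halfLine with hm
  have iφ : Integrable φ halfLine := (h1.continuous.integrable_of_hasCompactSupport h2).integrableOn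
  have iψ : Integrable ψ halfLine :=
    (hψ.smooth.continuous.integrable_of_hasCompactSupport hψ.compact).integrableOn
  -- subtracting a multiple of `ψ` from `φ` makes the mean vanish
  have ht : IsTestFunction (fun x => φ x - m * ψ x) := by
    refine ⟨h1.sub (contDiff_const.mul hψ.smooth), h2.sub (hψ.compact.mul_left), ?_⟩
    exact (tsupport_sub φ _).trans
      (union_subset h3 ((tsupport_mul_subset_right).trans hψ.support))
  obtain ⟨Φ, hΦ, hΦd⟩ := ht.exists_deriv_eq (by
    rw [integral_sub iφ (iψ.const_mul m), integral_const_mul, hψ1, mul_one, sub_self])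
  have h4 := h Φ hΦ
  rw [hΦd] at h4
  have i1 := hφ.integrable_mul hv
  have i2 := hψ.integrable_mul hv
  have h5 : ∫ x, v x * φ x ∂halfLine = m * c := by
    rw [hcdef, ← integral_const_mul, ← sub_eq_zero, ← integral_sub i1 (i2.const_mul m), ← h4]
    refine integral_congr_ae (Eventually.of_forall fun x => ?_)
    simp only
    ring
  have h6 : ∫ x, φ x • (v x - c) = ∫ x, φ x • (v x - c) ∂halfLine := by
    refine (setIntegral_eq_integral_of_forall_compl_eq_zero fun x hx => ?_).symm
    rw [hφ.eq_zero_of_nonpos (not_lt.1 hx), zero_smul]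
  have h7 : ∀ x, φ x • (v x - c) = v x * φ x - c * φ x := fun x => by
    rw [smul_eq_mul]; ring
  rw [h6]
  simp_rw [h7]
  rw [integral_sub i1 (iφ.const_mul c), h5, integral_const_mul]
  ring

/-- An absolutely continuous function in `L²` with derivative in `L²` is weakly differentiable. -/
theorem IsLocAC.isWeakDeriv {r w : ℝ → ℝ} (h : IsLocAC r w) {u v : L2}
    (hu : r =ᵐ[halfLine] u) (hv : w =ᵐ[halfLine] v) : IsWeakDeriv u v := by
  intro φ hφ
  have h1 := h.integral_mul_deriv hφ
  have h2 : ∫ x, r x * deriv φ x ∂halfLine = ∫ x, u x * deriv φ x ∂halfLine :=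
    integral_congr_ae (hu.mul (ae_eq_refl (deriv φ)))
  have h3 : ∫ x, w x * φ x ∂halfLine = ∫ x, v x * φ x ∂halfLine :=
    integral_congr_ae (hv.mul (ae_eq_refl φ))
  rw [← h2, ← h3, h1]

/-- A weakly differentiable function has an absolutely continuous representative: it differs from
the primitive of its weak derivative by a function with vanishing weak derivative. -/
theorem IsWeakDeriv.exists_isLocAC {u w : L2} (h : IsWeakDeriv u w) :
    ∃ r, IsLocAC r w ∧ r =ᵐ[halfLine] u := by
  have hR := IsLocAC.integral (w := w) fun b hb => L2.intervalIntegrable w hb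
  have iR : ∀ b, 0 ≤ b → IntervalIntegrable (fun x => ∫ t in 0..x, w t) volume 0 b := fun b hb =>
    ((hR.continuousOn).mono (by rw [uIcc_of_le hb]; exact Icc_subset_Ici_self)).intervalIntegrable
  obtain ⟨c, hc⟩ := ae_eq_const_of_integral_mul_deriv_eq_zero
    (v := fun x => u x - ∫ t in 0..x, w t)
    (fun b hb => (L2.intervalIntegrable u hb).sub (iR b hb)) fun φ hφ => by
      have h1 := h φ hφ
      have h2 := hR.integral_mul_deriv hφ
      simp_rw [sub_mul]
      rw [integral_sub (integrable_mul_deriv_test u hφ) (hφ.isTestFunction_deriv.integrable_mul iR), h1, h2,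
        sub_self]
  refine ⟨_, ((IsLocAC.const c).add hR).congr_right
    (Eventually.of_forall fun x => zero_add (w x)), ?_⟩
  filter_upwards [hc] with x hx
  linarith

/-! ### The Sobolev spaces as Banach spaces -/

theorem eqOn_Ici_of_ae_eq {r s : ℝ → ℝ} (hr : ContinuousOn r (Ici 0)) (hs : ContinuousOn s (Ici 0))
    (h : r =ᵐ[halfLine] s) : EqOn r s (Ici 0) := by
  refine Measure.eqOn_of_ae_eq (μ := volume) ?_ hr hs ?_
  · rwa [Measure.restrict_congr_set Ioi_ae_eq_Ici.symm]
  · rw [interior_Ici, closure_Ioi]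

theorem le_of_ae_le_halfLine {r : ℝ → ℝ} (hr : ContinuousOn r (Ici 0)) {c : ℝ}
    (h : ∀ᵐ x ∂halfLine, c ≤ r x) {x : ℝ} (hx : 0 ≤ x) : c ≤ r x := by
  have := eqOn_Ici_of_ae_eq (hr.sup continuousOn_const) hr (s := r)
    (r := fun x => r x ⊔ c) (h.mono fun x hx => max_eq_left hx) hx
  exact (le_max_right (r x) c).trans this.le

theorem IsLocAC.ae_eq_of_eqOn {r s w z : ℝ → ℝ} (h : IsLocAC r w) (h' : IsLocAC s z)
    (heq : EqOn r s (Ici 0)) : w =ᵐ[halfLine] z := by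
  filter_upwards [h.hasDerivAt, h'.hasDerivAt, ae_restrict_mem measurableSet_Ioi] with x hx hx' hx0
  refine hx.unique (hx'.congr_of_eventuallyEq ?_)
  filter_upwards [Ici_mem_nhds hx0] with y hy
  exact heq hy

theorem IsWeakDeriv.unique {u w z : L2} (h : IsWeakDeriv u w) (h' : IsWeakDeriv u z) : w = z := by
  obtain ⟨r, hr, hru⟩ := h.exists_isLocAC
  obtain ⟨s, hs, hsu⟩ := h'.exists_isLocAC
  exact Lp.ext (hr.ae_eq_of_eqOn hs
    (eqOn_Ici_of_ae_eq hr.continuousOn hs.continuousOn (hru.trans hsu.symm)))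

theorem IsWeakDeriv.isClosed : IsClosed {p : L2 × L2 | IsWeakDeriv p.1 p.2} := by
  have key : ∀ ψ : ℝ → ℝ, Continuous ψ → HasCompactSupport ψ →
      Continuous fun u : L2 => ∫ x, u x * ψ x ∂halfLine := by
    intro ψ hc hs
    have hm : MemLp ψ 2 halfLine := hc.memLp_of_hasCompactSupport hs
    have : (fun u : L2 => ∫ x, u x * ψ x ∂halfLine) = fun u => inner ℝ (hm.toLp ψ) u := by
      funext u
      rw [L2.inner_def]
      refine integral_congr_ae ?_
      filter_upwards [hm.coeFn_toLp] with x hx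
      rw [hx]
      rfl
    rw [this]
    exact continuous_const.inner continuous_id
  simp only [IsWeakDeriv, Set.ofPred_forall]
  refine isClosed_iInter fun φ => isClosed_iInter fun hφ => ?_
  exact isClosed_eq
    ((key _ (hφ.smooth.continuous_deriv (by simp)) hφ.compact.deriv).comp continuous_fst)
    ((key _ hφ.smooth.continuous hφ.compact).comp continuous_snd).neg

instance (n : ℕ) : CompleteSpace (Sobolev n) := by
  have hcl : IsClosed (sobolevSubmodule n : Set (PiLp 2 (fun _ : Fin (n + 1) => L2))) := by
    have : (sobolevSubmodule n : Set (PiLp 2 (fun _ : Fin (n + 1) => L2))) =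
        ⋂ k : Fin n, {U | IsWeakDeriv (U k.castSucc) (U k.succ)} := by
      ext U
      rw [mem_iInter]
      rfl
    rw [this]
    refine isClosed_iInter fun k => ?_
    have hc : Continuous fun U : PiLp 2 (fun _ : Fin (n + 1) => L2) => (U k.castSucc, U k.succ) :=
      (PiLp.continuous_apply 2 _ k.castSucc).prodMk (PiLp.continuous_apply 2 _ k.succ)
    exact IsWeakDeriv.isClosed.preimage hc
  exact hcl.completeSpace_coe

instance (n : ℕ) : Module ℝ (Sobolev n) := (sobolevSubmodule n).module

instance (n : ℕ) : MulAction ℝ (Sobolev n) := Module.toDistribMulAction.toMulAction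

namespace Sobolev

variable {n m : ℕ}

/-- The inclusion `Hⁿ ⊆ L²`. -/
def toL2 : Sobolev n →L[ℝ] L2 :=
  (PiLp.proj 2 (fun _ : Fin (n + 1) => L2) 0) ∘L (sobolevSubmodule n).subtypeL

theorem coeFn_toL2 (u : Sobolev n) : (toL2 u : ℝ → ℝ) = u.fn := rfl

theorem norm_sq_eq (u : Sobolev n) : ‖u‖ ^ 2 = ∑ k, ‖u.1 k‖ ^ 2 :=
  PiLp.norm_sq_eq_of_L2 _ u.1

theorem isWeakDeriv_dx (u : Sobolev (n + 1)) : IsWeakDeriv (toL2 u) (toL2 u.dx) := u.2 0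

/-- An element of `Hⁿ` is determined by its underlying function, as weak derivatives are unique. -/
theorem toL2_injective : Function.Injective (toL2 : Sobolev n → L2) := by
  intro u v h
  refine Subtype.ext (PiLp.ext fun k => ?_)
  induction k using Fin.induction with
  | zero => exact h
  | succ k ih => exact (u.2 k).unique (ih ▸ v.2 k)

theorem ext_fn {u v : Sobolev n} (h : u.fn =ᵐ[halfLine] v.fn) : u = v :=
  toL2_injective (Lp.ext h)

theorem fn_add (u v : Sobolev n) : (u + v).fn =ᵐ[halfLine] fun x => u.fn x + v.fn x :=
  Lp.coeFn_add (toL2 u) (toL2 v)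

theorem fn_sub (u v : Sobolev n) : (u - v).fn =ᵐ[halfLine] fun x => u.fn x - v.fn x :=
  Lp.coeFn_sub (toL2 u) (toL2 v)

theorem fn_neg (u : Sobolev n) : (-u).fn =ᵐ[halfLine] fun x => -u.fn x :=
  Lp.coeFn_neg (toL2 u)

theorem fn_smul (c : ℝ) (u : Sobolev n) : (c • u).fn =ᵐ[halfLine] fun x => c * u.fn x :=
  Lp.coeFn_smul c (toL2 u)

/-- The inclusion `Hⁿ⁺¹ ⊆ Hⁿ`. -/
def incl : Sobolev (n + 1) →L[ℝ] Sobolev n :=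
  LinearMap.mkContinuous
    { toFun := fun u => ⟨WithLp.toLp 2 (fun k => u.1 k.castSucc), fun k => u.2 k.castSucc⟩
      map_add' := fun _ _ => rfl
      map_smul' := fun _ _ => rfl } 1 fun u => by
    rw [one_mul]
    refine (sq_le_sq₀ (norm_nonneg _) (norm_nonneg _)).1 ?_
    rw [norm_sq_eq, norm_sq_eq, Fin.sum_univ_castSucc (n := n + 1)]
    exact le_add_of_nonneg_right (sq_nonneg _)

/-- The derivative `∂ₓ : Hⁿ⁺¹ → Hⁿ` as a continuous linear map. -/
def dxL : Sobolev (n + 1) →L[ℝ] Sobolev n :=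
  LinearMap.mkContinuous
    { toFun := dx
      map_add' := fun _ _ => rfl
      map_smul' := fun _ _ => rfl } 1 fun u => by
    rw [one_mul]
    refine (sq_le_sq₀ (norm_nonneg _) (norm_nonneg _)).1 ?_
    rw [norm_sq_eq, norm_sq_eq, Fin.sum_univ_succ (n := n + 1)]
    exact le_add_of_nonneg_left (sq_nonneg _)

theorem dxL_apply (u : Sobolev (n + 1)) : dxL u = u.dx := rfl

theorem toL2_incl (u : Sobolev (n + 1)) : toL2 (incl u) = toL2 u := rfl

theorem fn_incl (u : Sobolev (n + 1)) : (incl u).fn = u.fn := rfl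

theorem norm_incl_le (u : Sobolev (n + 1)) : ‖incl u‖ ≤ ‖u‖ :=
  (incl.le_of_opNorm_le (LinearMap.mkContinuous_norm_le _ zero_le_one _) u).trans_eq (one_mul _)

theorem norm_dx_le (u : Sobolev (n + 1)) : ‖u.dx‖ ≤ ‖u‖ :=
  (dxL.le_of_opNorm_le (LinearMap.mkContinuous_norm_le _ zero_le_one _) u).trans_eq (one_mul _)

theorem norm_toL2_le (u : Sobolev n) : ‖toL2 u‖ ≤ ‖u‖ := by
  refine (sq_le_sq₀ (norm_nonneg _) (norm_nonneg _)).1 ?_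
  rw [norm_sq_eq, Fin.sum_univ_succ]
  exact le_add_of_nonneg_right (Finset.sum_nonneg fun _ _ => sq_nonneg _)

theorem norm_toL2_sq_add_le (u : Sobolev (n + 1)) :
    ‖toL2 u‖ ^ 2 + ‖toL2 u.dx‖ ^ 2 ≤ ‖u‖ ^ 2 := by
  rw [norm_sq_eq, Fin.sum_univ_succ, Fin.sum_univ_succ, ← add_assoc]
  exact le_add_of_nonneg_right (Finset.sum_nonneg fun _ _ => sq_nonneg _)

/-- `L²` as the Sobolev space of order `0`. -/
def ofL2 (a : L2) : Sobolev 0 := ⟨WithLp.toLp 2 fun _ => a, fun k => k.elim0⟩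

theorem toL2_ofL2 (a : L2) : toL2 (ofL2 a) = a := rfl

theorem norm_ofL2 (a : L2) : ‖ofL2 a‖ = ‖a‖ := by
  refine (sq_eq_sq₀ (norm_nonneg _) (norm_nonneg _)).1 ?_
  rw [norm_sq_eq]
  simp [ofL2]

/-- A function in `L²` whose weak derivative is in `Hⁿ`, as an element of `Hⁿ⁺¹`. -/
def cons (a : L2) (W : Sobolev n) (h : IsWeakDeriv a (toL2 W)) : Sobolev (n + 1) :=
  ⟨WithLp.toLp 2 (Fin.cons a fun k => W.1 k), fun k => by
    refine Fin.cases h (fun i => ?_) k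
    exact W.2 i⟩

section cons

variable {a : L2} {W : Sobolev n} (h : IsWeakDeriv a (toL2 W))

theorem toL2_cons : toL2 (cons a W h) = a := rfl

theorem dx_cons : (cons a W h).dx = W := rfl

theorem norm_cons_le : ‖cons a W h‖ ≤ ‖a‖ + ‖W‖ := by
  refine (sq_le_sq₀ (norm_nonneg _) (by positivity)).1 ?_
  have h1 : ‖cons a W h‖ ^ 2 = ‖a‖ ^ 2 + ‖W‖ ^ 2 := by
    rw [norm_sq_eq, norm_sq_eq, Fin.sum_univ_succ]
    rfl
  rw [h1]
  nlinarith [norm_nonneg a, norm_nonneg W]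

end cons

/-- A linear map into `L²` whose values lie in `Hⁿ`, with a linear bound, is continuous into
`Hⁿ`. -/
theorem exists_lift {X : Type*} [NormedAddCommGroup X] [NormedSpace ℝ X] (T : X →ₗ[ℝ] L2) (C : ℝ)
    (h : ∀ x, ∃ v : Sobolev n, toL2 v = T x ∧ ‖v‖ ≤ C * ‖x‖) :
    ∃ L : X →L[ℝ] Sobolev n, ∀ x, toL2 (L x) = T x := by
  choose L hL hb using h
  exact ⟨LinearMap.mkContinuous
    { toFun := L
      map_add' := fun x y => toL2_injective (by simp [hL])
      map_smul' := fun c x => toL2_injective (by simp [hL]) } C hb, hL⟩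

/-! ### Boundary values and the sup bound -/

/-- The absolutely continuous representative of an element of `Hⁿ⁺¹` (determined on `[0, ∞)`
only). -/
def rep (u : Sobolev (n + 1)) : ℝ → ℝ := (isWeakDeriv_dx u).exists_isLocAC.choose

theorem isLocAC_rep (u : Sobolev (n + 1)) : IsLocAC u.rep u.dx.fn :=
  (isWeakDeriv_dx u).exists_isLocAC.choose_spec.1

theorem rep_ae_eq (u : Sobolev (n + 1)) : u.rep =ᵐ[halfLine] u.fn :=
  (isWeakDeriv_dx u).exists_isLocAC.choose_spec.2

theorem rep_eqOn {u : Sobolev (n + 1)} {r : ℝ → ℝ} (hr : ContinuousOn r (Ici 0))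
    (h : r =ᵐ[halfLine] u.fn) : EqOn u.rep r (Ici 0) :=
  eqOn_Ici_of_ae_eq u.isLocAC_rep.continuousOn hr (u.rep_ae_eq.trans h.symm)

theorem memLp_fn (u : Sobolev n) : MemLp u.fn 2 halfLine := Lp.memLp (toL2 u)

theorem integral_fn_sq (u : Sobolev n) : ∫ x, u.fn x ^ 2 ∂halfLine = ‖toL2 u‖ ^ 2 := by
  rw [← real_inner_self_eq_norm_sq, L2.inner_def]
  refine integral_congr_ae (Eventually.of_forall fun x => ?_)
  change u.fn x ^ 2 = u.fn x * u.fn x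
  ring

theorem integrable_mul_fn (u : Sobolev n) (v : Sobolev m) :
    Integrable (fun x => u.fn x * v.fn x) halfLine :=
  u.memLp_fn.integrable_mul v.memLp_fn

/-- The bound `sup |u| ≤ ‖u‖_{H¹}`, from `u(x)² = -2 ∫ₓ^∞ u ∂ₓu`. -/
theorem abs_rep_le (u : Sobolev (n + 1)) {x : ℝ} (hx : 0 ≤ x) : |u.rep x| ≤ ‖u‖ := by
  have h1 := u.isLocAC_rep.mul u.isLocAC_rep
  have hae := u.rep_ae_eq
  have i1 : Integrable (fun x => u.rep x * u.rep x) halfLine :=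
    (u.integrable_mul_fn u).congr (by filter_upwards [hae] with x hx; rw [hx])
  have e2 : (fun x => u.dx.fn x * u.rep x + u.rep x * u.dx.fn x) =ᵐ[halfLine]
      fun x => u.dx.fn x * u.fn x + u.dx.fn x * u.fn x := by
    filter_upwards [hae] with x hx
    rw [hx]
    ring
  have i2 := (u.dx.integrable_mul_fn u).add (u.dx.integrable_mul_fn u)
  have h2 := h1.abs_le_integral i1 (i2.congr e2.symm) hx
  have i3 : Integrable (fun x => u.fn x ^ 2) halfLine := u.memLp_fn.integrable_sq
  have i4 : Integrable (fun x => u.dx.fn x ^ 2) halfLine := u.dx.memLp_fn.integrable_sq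
  have h3 : ∫ x, |u.dx.fn x * u.rep x + u.rep x * u.dx.fn x| ∂halfLine ≤
      ∫ x, (u.fn x ^ 2 + u.dx.fn x ^ 2) ∂halfLine := by
    refine integral_mono_ae (i2.congr e2.symm).abs (i3.add i4) ?_
    filter_upwards [hae] with x hx
    rw [hx, abs_le]
    constructor <;> nlinarith [sq_nonneg (u.fn x + u.dx.fn x), sq_nonneg (u.fn x - u.dx.fn x)]
  rw [integral_add i3 i4, integral_fn_sq, integral_fn_sq] at h3
  have h4 : |u.rep x| ^ 2 ≤ ‖u‖ ^ 2 := by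
    rw [sq, ← abs_mul]
    exact h2.trans (h3.trans u.norm_toL2_sq_add_le)
  exact (sq_le_sq₀ (abs_nonneg _) (norm_nonneg _)).1 h4

theorem ae_abs_fn_le (u : Sobolev (n + 1)) : ∀ᵐ x ∂halfLine, |u.fn x| ≤ ‖u‖ := by
  filter_upwards [u.rep_ae_eq, ae_restrict_mem measurableSet_Ioi] with x hx hx0
  rw [← hx]
  exact u.abs_rep_le (le_of_lt hx0)

theorem trace_eq_of_continuousOn {g r : ℝ → ℝ} (hr : ContinuousOn r (Ici 0))
    (h : r =ᵐ[halfLine] g) : trace g = r 0 := by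
  have hex : ∃ c, HasTrace g c := ⟨r 0, r, hr, h, rfl⟩
  have : trace g = hex.choose := by
    rw [trace, dif_pos hex]
  rw [this]
  obtain ⟨w, hw, hwg, hw0⟩ := hex.choose_spec
  rw [← hw0]
  exact eqOn_Ici_of_ae_eq hw hr (hwg.trans h.symm) self_mem_Ici

theorem trace_fn (u : Sobolev (n + 1)) : trace u.fn = u.rep 0 :=
  trace_eq_of_continuousOn u.isLocAC_rep.continuousOn u.rep_ae_eq

/-- The trace at `0` as a continuous linear form on `Hⁿ⁺¹`. -/
def traceL : Sobolev (n + 1) →L[ℝ] ℝ :=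
  LinearMap.mkContinuous
    { toFun := fun u => u.rep 0
      map_add' := fun u v => rep_eqOn (r := fun x => u.rep x + v.rep x)
        (u.isLocAC_rep.continuousOn.add v.isLocAC_rep.continuousOn)
        ((u.rep_ae_eq.add v.rep_ae_eq).trans (fn_add u v).symm) self_mem_Ici
      map_smul' := fun c u => rep_eqOn (r := fun x => c * u.rep x)
        (continuousOn_const.mul u.isLocAC_rep.continuousOn)
        (by filter_upwards [u.rep_ae_eq, fn_smul c u] with x h1 h2; rw [h2, h1])
        self_mem_Ici } 1 fun u => by
    rw [one_mul]
    exact u.abs_rep_le le_rfl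

theorem traceL_apply (u : Sobolev (n + 1)) : traceL u = u.rep 0 := rfl

theorem trace_eq_traceL (u : Sobolev (n + 1)) : trace u.fn = traceL u := u.trace_fn

/-! ### The Banach algebra structure of `Hⁿ⁺¹` and reciprocals -/

theorem exists_L2_of_abs_le {g : ℝ → ℝ} (hg : AEStronglyMeasurable g halfLine) (a : L2) (C : ℝ)
    (h : ∀ᵐ x ∂halfLine, |g x| ≤ C * |a x|) :
    ∃ p : L2, p =ᵐ[halfLine] g ∧ ‖p‖ ≤ C * ‖a‖ := by
  have hm : MemLp g 2 halfLine := (Lp.memLp a).of_le_mul hg h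
  refine ⟨hm.toLp g, hm.coeFn_toLp, Lp.norm_le_mul_norm_of_ae_le_mul ?_⟩
  filter_upwards [h, hm.coeFn_toLp] with x hx hx'
  rw [hx']
  exact hx

theorem exists_L2_mul (a : L2) (v : Sobolev (n + 1)) :
    ∃ p : L2, p =ᵐ[halfLine] (fun x => a x * v.fn x) ∧ ‖p‖ ≤ ‖v‖ * ‖a‖ := by
  refine exists_L2_of_abs_le ((Lp.memLp a).1.mul v.memLp_fn.1) a ‖v‖ ?_
  filter_upwards [v.ae_abs_fn_le] with x hx
  change |a x * v.fn x| ≤ _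
  rw [abs_mul, mul_comm]
  exact mul_le_mul_of_nonneg_right hx (abs_nonneg _)

/-- The Leibniz rule for weak derivatives. -/
theorem isWeakDeriv_mul (u : Sobolev (n + 1)) (v : Sobolev (m + 1)) {p d : L2}
    (hp : p =ᵐ[halfLine] fun x => u.fn x * v.fn x)
    (hd : d =ᵐ[halfLine] fun x => u.dx.fn x * v.fn x + u.fn x * v.dx.fn x) : IsWeakDeriv p d := by
  refine (u.isLocAC_rep.mul v.isLocAC_rep).isWeakDeriv ?_ ?_
  · exact (u.rep_ae_eq.mul v.rep_ae_eq).trans hp.symm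
  · filter_upwards [u.rep_ae_eq, v.rep_ae_eq, hd] with x h1 h2 h3
    rw [h1, h2, h3]

/-- `Hⁿ⁺¹` acts on `Hⁿ` by multiplication. -/
theorem exists_mul_succ (n : ℕ) : ∃ C : ℝ, ∀ (u : Sobolev n) (v : Sobolev (n + 1)),
    ∃ p : Sobolev n, p.fn =ᵐ[halfLine] (fun x => u.fn x * v.fn x) ∧ ‖p‖ ≤ C * (‖u‖ * ‖v‖) := by
  induction n with
  | zero =>
    refine ⟨1, fun u v => ?_⟩
    obtain ⟨p, hp, hpn⟩ := exists_L2_mul (toL2 u) v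
    refine ⟨ofL2 p, hp, ?_⟩
    rw [norm_ofL2, one_mul, mul_comm]
    exact hpn.trans (mul_le_mul_of_nonneg_left u.norm_toL2_le (norm_nonneg _))
  | succ n ih =>
    obtain ⟨C, hC⟩ := ih
    refine ⟨1 + |C| + |C|, fun u v => ?_⟩
    obtain ⟨p, hp, hpn⟩ := exists_L2_mul (toL2 u) v
    obtain ⟨W₁, h₁, b₁⟩ := hC u.dx (incl v)
    obtain ⟨W₂, h₂, b₂⟩ := hC (incl v.dx) u
    have hW : IsWeakDeriv p (toL2 (W₁ + W₂)) := by
      refine isWeakDeriv_mul u v hp ?_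
      filter_upwards [fn_add W₁ W₂, h₁, h₂] with x e e₁ e₂
      change (W₁ + W₂).fn x = _
      rw [e, e₁, e₂, fn_incl, fn_incl, mul_comm (v.dx.fn x)]
    refine ⟨cons p _ hW, hp, (norm_cons_le hW).trans ?_⟩
    have c₁ : ‖W₁‖ ≤ |C| * (‖u‖ * ‖v‖) := b₁.trans <| mul_le_mul (le_abs_self C)
      (mul_le_mul u.norm_dx_le v.norm_incl_le (norm_nonneg _) (norm_nonneg _))
      (by positivity) (abs_nonneg _)
    have c₂ : ‖W₂‖ ≤ |C| * (‖u‖ * ‖v‖) := by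
      rw [mul_comm ‖u‖]
      exact b₂.trans <| mul_le_mul (le_abs_self C)
        (mul_le_mul_of_nonneg_right ((norm_incl_le _).trans v.norm_dx_le) (norm_nonneg _))
        (by positivity) (abs_nonneg _)
    have c₀ : ‖p‖ ≤ ‖u‖ * ‖v‖ := by
      rw [mul_comm ‖u‖]
      exact hpn.trans (mul_le_mul_of_nonneg_left u.norm_toL2_le (norm_nonneg _))
    linarith [norm_add_le W₁ W₂]

/-- `Hⁿ⁺¹` is an algebra. -/
theorem exists_mul (n : ℕ) : ∃ C : ℝ, ∀ u v : Sobolev (n + 1),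
    ∃ p : Sobolev (n + 1), p.fn =ᵐ[halfLine] (fun x => u.fn x * v.fn x) ∧
      ‖p‖ ≤ C * ‖u‖ * ‖v‖ := by
  obtain ⟨C, hC⟩ := exists_mul_succ n
  refine ⟨1 + |C| + |C|, fun u v => ?_⟩
  obtain ⟨p, hp, hpn⟩ := exists_L2_mul (toL2 u) v
  obtain ⟨W₁, h₁, b₁⟩ := hC u.dx v
  obtain ⟨W₂, h₂, b₂⟩ := hC v.dx u
  have hW : IsWeakDeriv p (toL2 (W₁ + W₂)) := by
    refine isWeakDeriv_mul u v hp ?_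
    filter_upwards [fn_add W₁ W₂, h₁, h₂] with x e e₁ e₂
    change (W₁ + W₂).fn x = _
    rw [e, e₁, e₂, mul_comm (v.dx.fn x)]
  refine ⟨cons p _ hW, hp, (norm_cons_le hW).trans ?_⟩
  have c₁ : ‖W₁‖ ≤ |C| * (‖u‖ * ‖v‖) := b₁.trans <| mul_le_mul (le_abs_self C)
    (mul_le_mul_of_nonneg_right u.norm_dx_le (norm_nonneg _)) (by positivity) (abs_nonneg _)
  have c₂ : ‖W₂‖ ≤ |C| * (‖u‖ * ‖v‖) := by
    rw [mul_comm ‖u‖]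
    exact b₂.trans <| mul_le_mul (le_abs_self C)
      (mul_le_mul_of_nonneg_right v.norm_dx_le (norm_nonneg _)) (by positivity) (abs_nonneg _)
  have c₀ : ‖p‖ ≤ ‖u‖ * ‖v‖ := by
    rw [mul_comm ‖u‖]
    exact hpn.trans (mul_le_mul_of_nonneg_left u.norm_toL2_le (norm_nonneg _))
  linarith [norm_add_le W₁ W₂]

/-- Multiplication in `Hⁿ⁺¹` as a bounded bilinear map. -/
def mulL : Sobolev (n + 1) →L[ℝ] Sobolev (n + 1) →L[ℝ] Sobolev (n + 1) :=
  let M := (exists_mul n).choose_spec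
  LinearMap.mkContinuous₂
    (LinearMap.mk₂ ℝ (fun u v => (M u v).choose)
      (fun u u' v => ext_fn <| by
        filter_upwards [(M (u + u') v).choose_spec.1, (M u v).choose_spec.1,
          (M u' v).choose_spec.1, fn_add (M u v).choose (M u' v).choose, fn_add u u']
          with x h1 h2 h3 h4 h5
        rw [h1, h4, h2, h3, h5, add_mul])
      (fun c u v => ext_fn <| by
        filter_upwards [(M (c • u) v).choose_spec.1, (M u v).choose_spec.1,
          fn_smul c (M u v).choose, fn_smul c u] with x h1 h2 h3 h4
        rw [h1, h3, h2, h4, mul_assoc])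
      (fun u v v' => ext_fn <| by
        filter_upwards [(M u (v + v')).choose_spec.1, (M u v).choose_spec.1,
          (M u v').choose_spec.1, fn_add (M u v).choose (M u v').choose, fn_add v v']
          with x h1 h2 h3 h4 h5
        rw [h1, h4, h2, h3, h5, mul_add])
      (fun c u v => ext_fn <| by
        filter_upwards [(M u (c • v)).choose_spec.1, (M u v).choose_spec.1,
          fn_smul c (M u v).choose, fn_smul c v] with x h1 h2 h3 h4
        rw [h1, h3, h2, h4, mul_left_comm]))
    (exists_mul n).choose fun u v => (M u v).choose_spec.2

theorem fn_mulL (u v : Sobolev (n + 1)) :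
    (mulL u v).fn =ᵐ[halfLine] fun x => u.fn x * v.fn x :=
  ((exists_mul n).choose_spec u v).choose_spec.1

theorem exists_norm_mulL_le (n : ℕ) :
    ∃ c : ℝ, 0 ≤ c ∧ ∀ u v : Sobolev (n + 1), ‖mulL u v‖ ≤ c * ‖u‖ * ‖v‖ := by
  refine ⟨|(exists_mul n).choose|, abs_nonneg _, fun u v => ?_⟩
  refine ((exists_mul n).choose_spec u v).choose_spec.2.trans ?_
  rw [mul_assoc, mul_assoc]
  exact mul_le_mul_of_nonneg_right (le_abs_self _) (by positivity)

theorem rep_mulL (u v : Sobolev (n + 1)) :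
    EqOn (mulL u v).rep (fun x => u.rep x * v.rep x) (Ici 0) :=
  rep_eqOn (u.isLocAC_rep.mul v.isLocAC_rep).continuousOn
    ((u.rep_ae_eq.mul v.rep_ae_eq).trans (fn_mulL u v).symm)

theorem _root_.AbbottBoussinesq.PositiveDepth.le_rep {ε : ℝ} {ζ : Sobolev (n + 1)}
    (h : PositiveDepth ε ζ.fn) : ∃ c > 0, ∀ x, 0 ≤ x → c ≤ 1 + ε * ζ.rep x := by
  obtain ⟨c, hc, h⟩ := h
  refine ⟨c, hc, fun x hx => le_of_ae_le_halfLine (r := fun x => 1 + ε * ζ.rep x) ?_ ?_ hx⟩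
  · exact continuousOn_const.add (continuousOn_const.mul ζ.isLocAC_rep.continuousOn)
  · filter_upwards [h, ζ.rep_ae_eq] with x hx hx'
    rwa [hx']

/-- The weak derivative of `1 / h` is `-∂ₓh / h²`. -/
theorem isWeakDeriv_recip {ε : ℝ} {ζ : Sobolev (n + 1)} (h : PositiveDepth ε ζ.fn) {g d : L2}
    (hg : ∀ᵐ x ∂halfLine, (1 + ε * ζ.fn x) * (1 + g x) = 1)
    (hd : ∀ᵐ x ∂halfLine, d x = -ε * (ζ.dx.fn x * (1 + g x) ^ 2)) : IsWeakDeriv g d := by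
  obtain ⟨c, hc, hcr⟩ := h.le_rep
  have h1 := (((IsLocAC.const 1).add (ζ.isLocAC_rep.const_mul ε)).inv hc hcr).add
    (IsLocAC.const (-1))
  have key : ∀ᵐ x ∂halfLine, (1 + ε * ζ.rep x)⁻¹ = 1 + g x := by
    filter_upwards [hg, ζ.rep_ae_eq] with x hx hx'
    rw [hx']
    exact inv_eq_of_mul_eq_one_right hx
  refine h1.isWeakDeriv ?_ ?_
  · filter_upwards [key] with x hx
    rw [hx]
    ring
  · filter_upwards [key, hd] with x hx hx'
    rw [hx', ← hx, div_eq_mul_inv, ← inv_pow]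
    ring

/-- The reciprocal of `1 + ε ζ` differs from `1` by an element of `Hⁿ⁺¹`. In the induction the
derivative of `1 + g` is `-ε ∂ₓζ (1 + g)²`, a product in the space of one order less. -/
theorem exists_recip {ε : ℝ} (n : ℕ) (ζ : Sobolev (n + 1)) (h : PositiveDepth ε ζ.fn) :
    ∃ g : Sobolev (n + 1), ∀ᵐ x ∂halfLine, (1 + ε * ζ.fn x) * (1 + g.fn x) = 1 := by
  induction n with
  | zero =>
    have hm := ζ.memLp_fn.1
    have hm' := ζ.dx.memLp_fn.1
    obtain ⟨c, hc, hcz⟩ := id h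
    have hden : AEStronglyMeasurable (fun x => (1 + ε * ζ.fn x)⁻¹) halfLine :=
      ((hm.const_mul ε).const_add 1).aemeasurable.inv.aestronglyMeasurable
    have hle : ∀ᵐ x ∂halfLine, |(1 + ε * ζ.fn x)⁻¹| ≤ c⁻¹ := by
      filter_upwards [hcz] with x hx
      rw [abs_of_pos (inv_pos.2 (hc.trans_le hx))]
      exact inv_anti₀ hc hx
    obtain ⟨g, hg, -⟩ := exists_L2_of_abs_le (g := fun x => -ε * ζ.fn x * (1 + ε * ζ.fn x)⁻¹)
      ((hm.const_mul (-ε)).mul hden) (toL2 ζ) (|ε| * c⁻¹) (by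
        filter_upwards [hle] with x hx
        rw [abs_mul, abs_mul, abs_neg, mul_right_comm]
        exact mul_le_mul_of_nonneg_right (mul_le_mul_of_nonneg_left hx (abs_nonneg _))
          (abs_nonneg _))
    obtain ⟨d, hd, -⟩ := exists_L2_of_abs_le
      (g := fun x => -ε * ζ.dx.fn x * ((1 + ε * ζ.fn x)⁻¹ * (1 + ε * ζ.fn x)⁻¹))
      ((hm'.const_mul (-ε)).mul (hden.mul hden)) (toL2 ζ.dx) (|ε| * (c⁻¹ * c⁻¹)) (by
        filter_upwards [hle] with x hx
        rw [abs_mul, abs_mul, abs_neg, abs_mul, mul_right_comm]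
        refine mul_le_mul_of_nonneg_right (mul_le_mul_of_nonneg_left ?_ (abs_nonneg _))
          (abs_nonneg _)
        exact mul_le_mul hx hx (abs_nonneg _) (inv_pos.2 hc).le)
    have hgr : ∀ᵐ x ∂halfLine, 1 + g x = (1 + ε * ζ.fn x)⁻¹ := by
      filter_upwards [hg, hcz] with x hx hx'
      have : 1 + ε * ζ.fn x ≠ 0 := (hc.trans_le hx').ne'
      rw [hx]
      field_simp
      ring
    have hgr' : ∀ᵐ x ∂halfLine, (1 + ε * ζ.fn x) * (1 + g x) = 1 := by
      filter_upwards [hgr, hcz] with x hx hx'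
      rw [hx, mul_inv_cancel₀ (hc.trans_le hx').ne']
    have hw : IsWeakDeriv g (toL2 (ofL2 d)) := by
      refine isWeakDeriv_recip h hgr' ?_
      filter_upwards [hd, hgr] with x hx hx'
      rw [toL2_ofL2, hx, hx']
      ring
    exact ⟨cons g (ofL2 d) hw, hgr'⟩
  | succ n ih =>
    obtain ⟨g, hg⟩ := ih (incl ζ) h
    let W : Sobolev (n + 1) := (-ε) • (ζ.dx + (2 : ℝ) • mulL ζ.dx g + mulL (mulL ζ.dx g) g)
    have hw : IsWeakDeriv (toL2 g) (toL2 W) := by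
      refine isWeakDeriv_recip h hg ?_
      filter_upwards [fn_smul (-ε) (ζ.dx + (2 : ℝ) • mulL ζ.dx g + mulL (mulL ζ.dx g) g),
        fn_add (ζ.dx + (2 : ℝ) • mulL ζ.dx g) (mulL (mulL ζ.dx g) g),
        fn_add ζ.dx ((2 : ℝ) • mulL ζ.dx g), fn_smul 2 (mulL ζ.dx g), fn_mulL ζ.dx g,
        fn_mulL (mulL ζ.dx g) g] with x h1 h2 h3 h4 h5 h6
      change W.fn x = _
      change W.fn x = _ at h1
      rw [h1, h2, h3, h4, h6, h5, coeFn_toL2]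
      ring
    exact ⟨cons (toL2 g) W hw, hg⟩

/-! ### The Neumann problem -/

/-- Integration by parts on the half-line. -/
theorem integral_dx_mul_add (u : Sobolev (n + 1)) (v : Sobolev (m + 1)) :
    ∫ x, u.dx.fn x * v.fn x ∂halfLine + ∫ x, u.fn x * v.dx.fn x ∂halfLine =
      -(u.rep 0 * v.rep 0) := by
  have h := u.isLocAC_rep.mul v.isLocAC_rep
  have e1 : (fun x => u.rep x * v.rep x) =ᵐ[halfLine] fun x => u.fn x * v.fn x :=
    u.rep_ae_eq.mul v.rep_ae_eq
  have e2 : (fun x => u.dx.fn x * v.rep x + u.rep x * v.dx.fn x) =ᵐ[halfLine]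
      fun x => u.dx.fn x * v.fn x + u.fn x * v.dx.fn x := by
    filter_upwards [u.rep_ae_eq, v.rep_ae_eq] with x h1 h2
    rw [h1, h2]
  have i1 := u.dx.integrable_mul_fn v
  have i2 := u.integrable_mul_fn v.dx
  rw [← h.integral_halfLine ((u.integrable_mul_fn v).congr e1.symm) ((i1.add i2).congr e2.symm),
    integral_congr_ae e2, integral_add i1 i2]

theorem toL2_dx_congr {u : Sobolev (n + 1)} {v : Sobolev (m + 1)} (h : toL2 u = toL2 v) :
    toL2 u.dx = toL2 v.dx :=
  u.isWeakDeriv_dx.unique (h ▸ v.isWeakDeriv_dx)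

theorem fn_congr {u : Sobolev n} {v : Sobolev m} (h : toL2 u = toL2 v) : u.fn = v.fn :=
  congrArg (fun a : L2 => (a : ℝ → ℝ)) h

theorem inner_toL2 (u : Sobolev n) (v : Sobolev m) :
    inner ℝ (toL2 u) (toL2 v) = ∫ x, u.fn x * v.fn x ∂halfLine := by
  rw [L2.inner_def]
  refine integral_congr_ae (Eventually.of_forall fun x => ?_)
  exact mul_comm (v.fn x) (u.fn x)

/-- The function `x ↦ exp (-x / d)` as an element of every Sobolev space. -/
theorem exists_exp (n : ℕ) {d : ℝ} (hd : 0 < d) :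
    ∃ e : Sobolev n, e.fn =ᵐ[halfLine] fun x => Real.exp (-x / d) := by
  have hder : ∀ x, HasDerivAt (fun x => Real.exp (-x / d)) (-1 / d * Real.exp (-x / d)) x :=
    fun x => by
      rw [mul_comm]
      exact ((hasDerivAt_id x).neg.div_const d).exp
  have hcd : ContDiff ℝ 1 fun x => Real.exp (-x / d) := by fun_prop
  have hm : MemLp (fun x => Real.exp (-x / d)) 2 halfLine := by
    rw [memLp_two_iff_integrable_sq hcd.continuous.aestronglyMeasurable]
    refine (exp_neg_integrableOn_Ioi 0 (b := 2 / d) (by positivity)).congr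
      (Eventually.of_forall fun x => ?_)
    change Real.exp (-(2 / d) * x) = Real.exp (-x / d) ^ 2
    rw [← Real.exp_nat_mul]
    congr 1
    push_cast
    ring
  have hL : IsLocAC (fun x => Real.exp (-x / d)) fun x => -1 / d * Real.exp (-x / d) :=
    (IsLocAC.of_contDiff hcd).congr_right (Eventually.of_forall fun x => (hder x).deriv)
  have hw : IsWeakDeriv (hm.toLp _) ((-1 / d) • hm.toLp _) := by
    refine hL.isWeakDeriv hm.coeFn_toLp.symm ?_
    filter_upwards [Lp.coeFn_smul (-1 / d) (hm.toLp _), hm.coeFn_toLp] with x h1 h2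
    rw [h1, Pi.smul_apply, h2, smul_eq_mul]
  refine ⟨⟨WithLp.toLp 2 fun k => (-1 / d) ^ (k : ℕ) • hm.toLp _, fun k => ?_⟩, ?_⟩
  · have := hw.smul ((-1 / d) ^ (k : ℕ))
    rwa [smul_smul, ← pow_succ] at this
  · have : ((-1 / d) ^ ((0 : Fin (n + 1)) : ℕ) • hm.toLp _ : L2) = hm.toLp _ := by
      rw [Fin.val_zero, pow_zero, one_smul]
    change (((-1 / d) ^ ((0 : Fin (n + 1)) : ℕ) • hm.toLp _ : L2) : ℝ → ℝ) =ᵐ[halfLine] _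
    rw [this]
    exact hm.coeFn_toLp

theorem rep_exp {e : Sobolev (n + 1)} {d : ℝ}
    (he : e.fn =ᵐ[halfLine] fun x => Real.exp (-x / d)) : e.rep 0 = 1 := by
  have hc : Continuous fun x => Real.exp (-x / d) := by fun_prop
  rw [rep_eqOn hc.continuousOn he.symm self_mem_Ici]
  simp

/-- The energy form `∫ u v + a ∫ ∂ₓu ∂ₓv` of the Neumann problem on `H¹`. -/
def energy (a : ℝ) : Sobolev 1 →L[ℝ] Sobolev 1 →L[ℝ] ℝ :=
  let B : L2 →L[ℝ] L2 →L[ℝ] ℝ := innerSL ℝ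
  B.bilinearComp toL2 toL2 + a • B.bilinearComp (toL2 ∘L dxL) (toL2 ∘L dxL)

theorem energy_apply (a : ℝ) (u v : Sobolev 1) :
    energy a u v = inner ℝ (toL2 u) (toL2 v) + a * inner ℝ (toL2 u.dx) (toL2 v.dx) := rfl

theorem isCoercive_energy {a : ℝ} (ha : 0 < a) : IsCoercive (energy a) := by
  refine ⟨min 1 a, lt_min one_pos ha, fun u => ?_⟩
  rw [energy_apply, real_inner_self_eq_norm_sq, real_inner_self_eq_norm_sq, mul_assoc, ← sq,
    norm_sq_eq, Fin.sum_univ_two, mul_add]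
  exact add_le_add (mul_le_of_le_one_left (sq_nonneg _) (min_le_left _ _))
    (mul_le_mul_of_nonneg_right (min_le_right _ _) (sq_nonneg _))

/-- The variational solution operator of `u - a ∂ₓ²u = g`, `∂ₓu(0) = 0`. -/
theorem exists_energy_solution {a : ℝ} (ha : 0 < a) : ∃ S : L2 →L[ℝ] Sobolev 1,
    ∀ g v, energy a (S g) v = inner ℝ g (toL2 v) := by
  let E := (isCoercive_energy ha).continuousLinearEquivOfBilin
  refine ⟨(E.symm : Sobolev 1 →L[ℝ] Sobolev 1) ∘L (toL2 : Sobolev 1 →L[ℝ] L2).adjoint,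
    fun g v => ?_⟩
  rw [← (isCoercive_energy ha).continuousLinearEquivOfBilin_apply]
  change inner ℝ (E (E.symm _)) v = _
  rw [E.apply_symm_apply]
  exact ContinuousLinearMap.adjoint_inner_left _ _ _

/-- The variational solution satisfies `∂ₓ²u = (u - g) / a`, by testing with test functions. -/
theorem isWeakDeriv_dx_of_energy {a : ℝ} (ha : 0 < a) {g : L2} {u : Sobolev 1}
    (h : ∀ v, energy a u v = inner ℝ g (toL2 v)) :
    IsWeakDeriv (toL2 u.dx) (a⁻¹ • (toL2 u - g)) := by
  intro φ hφ
  have hm : MemLp φ 2 halfLine := hφ.smooth.continuous.memLp_of_hasCompactSupport hφ.compact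
  have hm' : MemLp (deriv φ) 2 halfLine :=
    hφ.isTestFunction_deriv.smooth.continuous.memLp_of_hasCompactSupport hφ.isTestFunction_deriv.compact
  have hw : IsWeakDeriv (hm.toLp φ) (toL2 (ofL2 (hm'.toLp _))) :=
    (IsLocAC.of_contDiff (hφ.smooth.of_le (by simp))).isWeakDeriv hm.coeFn_toLp.symm
      hm'.coeFn_toLp.symm
  have key : ∀ (w : L2) (ψ : ℝ → ℝ) (hψ : MemLp ψ 2 halfLine),
      inner ℝ w (hψ.toLp ψ) = ∫ x, w x * ψ x ∂halfLine := by
    intro w ψ hψ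
    rw [L2.inner_def]
    refine integral_congr_ae ?_
    filter_upwards [hψ.coeFn_toLp] with x hx
    rw [hx]
    exact mul_comm _ _
  have h1 := h (cons _ _ hw)
  rw [energy_apply, toL2_cons, dx_cons, toL2_ofL2, key _ _ hm'] at h1
  have h2 : ∫ x, (a⁻¹ • (toL2 u - g) : L2) x * φ x ∂halfLine =
      a⁻¹ * (inner ℝ (toL2 u) (hm.toLp φ) - inner ℝ g (hm.toLp φ)) := by
    rw [← key _ _ hm, real_inner_smul_left, inner_sub_left]
  rw [h2, ← h1]
  field_simp
  ring

/-- The derivative at `0` of the variational solution vanishes: the natural boundary condition. -/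
theorem rep_dx_eq_zero_of_energy {a : ℝ} (ha : 0 < a) {g : L2} {u : Sobolev 1}
    (h : ∀ v, energy a u v = inner ℝ g (toL2 v)) {w : Sobolev (n + 2)} (hw : toL2 w = toL2 u) :
    w.dx.rep 0 = 0 := by
  obtain ⟨e, he⟩ := exists_exp 1 one_pos
  have h1 := integral_dx_mul_add w.dx e
  have h2 : toL2 w.dx = toL2 u.dx := toL2_dx_congr hw
  have h3 : toL2 w.dx.dx = a⁻¹ • (toL2 u - g) :=
    w.dx.isWeakDeriv_dx.unique (h2 ▸ isWeakDeriv_dx_of_energy ha h)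
  have h4 := h e
  rw [energy_apply] at h4
  rw [← inner_toL2, ← inner_toL2, h3, h2, real_inner_smul_left, inner_sub_left, rep_exp he] at h1
  have h5 : a⁻¹ * (inner ℝ (toL2 u) (toL2 e) - inner ℝ g (toL2 e)) +
      inner ℝ (toL2 u.dx) (toL2 e.dx) = 0 := by
    rw [← h4]
    field_simp
    ring
  linarith

/-- The homogeneous Neumann problem has no nonzero solution. -/
theorem eq_zero_of_neumann {a : ℝ} (ha : 0 < a) {w : Sobolev 2}
    (h : ∀ᵐ x ∂halfLine, w.fn x - a * w.dx.dx.fn x = 0) (h0 : w.dx.rep 0 = 0) : w = 0 := by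
  have h1 := integral_dx_mul_add w.dx w
  have h2 : ∫ x, w.dx.dx.fn x * w.fn x ∂halfLine = a⁻¹ * ‖toL2 w‖ ^ 2 := by
    rw [← integral_fn_sq, ← integral_const_mul]
    refine integral_congr_ae ?_
    filter_upwards [h] with x hx
    have : w.fn x = a * w.dx.dx.fn x := by linarith
    rw [this]
    field_simp
  rw [h0, zero_mul, neg_zero, h2, ← inner_toL2, real_inner_self_eq_norm_sq] at h1
  have h3 : a⁻¹ * ‖toL2 w‖ ^ 2 = 0 := by
    have := inv_pos.2 ha
    nlinarith [sq_nonneg ‖toL2 w.dx‖, mul_nonneg this.le (sq_nonneg ‖toL2 w‖)]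
  have h4 : toL2 w = 0 := by
    simpa [ha.ne'] using h3
  exact toL2_injective (h4.trans (map_zero _).symm)

theorem _root_.AbbottBoussinesq.SolvesNeumann.eq_R₁ {μ : ℝ} (hμ : 0 < μ) {g : ℝ → ℝ}
    {v : Sobolev 2} (h : SolvesNeumann μ g v) : R₁ μ g = v := by
  have hex : ∃ v, SolvesNeumann μ g v := ⟨v, h⟩
  have h1 : R₁ μ g = hex.choose := by rw [R₁, dif_pos hex]
  rw [h1, ← sub_eq_zero]
  have h2 := hex.choose_spec
  refine eq_zero_of_neumann (a := μ / 3) (by positivity) ?_ ?_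
  · filter_upwards [h.1, h2.1, fn_sub hex.choose v, fn_sub hex.choose.dx.dx v.dx.dx]
      with x e1 e2 e3 e4
    have e5 : (hex.choose - v).dx.dx.fn x = hex.choose.dx.dx.fn x - v.dx.dx.fn x := e4
    rw [e3, e5]
    linarith
  · have h3 := h.2
    have h4 := h2.2
    rw [trace_eq_traceL] at h3 h4
    have : traceL (hex.choose - v).dx = traceL hex.choose.dx - traceL v.dx :=
      map_sub traceL hex.choose.dx v.dx
    rw [← traceL_apply, this, h3, h4, sub_zero]

/-- Elliptic regularity: the Neumann solution operator maps `Hⁿ` to `Hⁿ⁺²`. -/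
theorem exists_neumann {μ : ℝ} (hμ : 0 < μ) (n : ℕ) :
    ∃ N : Sobolev n →L[ℝ] Sobolev (n + 2), ∀ g,
      (∀ G : ℝ → ℝ, G =ᵐ[halfLine] g.fn → toL2 (R₁ μ G) = toL2 (N g)) ∧
      ∀ᵐ x ∂halfLine, (N g).fn x - μ / 3 * (N g).dx.dx.fn x = g.fn x := by
  have ha : 0 < μ / 3 := by positivity
  obtain ⟨S, hS⟩ := exists_energy_solution ha
  -- the equation gains two derivatives
  have step : ∀ (k : ℕ) (g : Sobolev k) (v : Sobolev (k + 1)), toL2 v = toL2 (S (toL2 g)) →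
      ∃ w : Sobolev (k + 2), toL2 w = toL2 v ∧
        ‖w‖ ≤ 2 * ‖v‖ + (μ / 3)⁻¹ * (‖v‖ + ‖g‖) := by
    intro k g v hv
    have h1 : IsWeakDeriv (toL2 v.dx) (toL2 ((μ / 3)⁻¹ • (incl v - g))) := by
      rw [map_smul, map_sub, toL2_incl, toL2_dx_congr hv, hv]
      exact isWeakDeriv_dx_of_energy ha (hS _)
    refine ⟨cons (toL2 v) (cons (toL2 v.dx) _ h1) v.isWeakDeriv_dx, rfl, ?_⟩
    have b1 := norm_cons_le h1
    have b2 := norm_cons_le (a := toL2 v) (W := cons (toL2 v.dx) _ h1) v.isWeakDeriv_dx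
    rw [norm_smul, Real.norm_of_nonneg (inv_pos.2 ha).le] at b1
    have b3 := mul_le_mul_of_nonneg_left ((norm_sub_le (incl v) g).trans
      (add_le_add_left v.norm_incl_le ‖g‖)) (inv_pos.2 ha).le
    have b4 := v.norm_toL2_le
    have b5 := v.dx.norm_toL2_le.trans v.norm_dx_le
    linarith
  have bound : ∀ k : ℕ, ∃ C, ∀ g : Sobolev k, ∃ v : Sobolev (k + 1),
      toL2 v = toL2 (S (toL2 g)) ∧ ‖v‖ ≤ C * ‖g‖ := by
    intro k
    induction k with
    | zero =>
      exact ⟨‖S‖, fun g => ⟨S (toL2 g), rfl, (S.le_opNorm _).trans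
        (mul_le_mul_of_nonneg_left g.norm_toL2_le S.opNorm_nonneg)⟩⟩
    | succ k ih =>
      obtain ⟨C, hC⟩ := ih
      refine ⟨2 * |C| + (μ / 3)⁻¹ * (|C| + 1), fun g => ?_⟩
      obtain ⟨v, hv, hvb⟩ := hC (incl g)
      obtain ⟨w, hw, hwb⟩ := step k (incl g) v hv
      refine ⟨w, hw.trans hv, hwb.trans ?_⟩
      have b1 := g.norm_incl_le
      have b2 : ‖v‖ ≤ |C| * ‖g‖ := hvb.trans
        (mul_le_mul (le_abs_self C) b1 (norm_nonneg _) (abs_nonneg _))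
      have b3 := mul_le_mul_of_nonneg_left (add_le_add b2 b1) (inv_pos.2 ha).le
      linarith
  obtain ⟨C, hC⟩ := bound n
  obtain ⟨N, hN⟩ := exists_lift (n := n + 2) ((toL2 : Sobolev 1 →L[ℝ] L2) ∘L S ∘L toL2).toLinearMap
    (2 * |C| + (μ / 3)⁻¹ * (|C| + 1)) fun g : Sobolev n => by
      obtain ⟨v, hv, hvb⟩ := hC g
      obtain ⟨w, hw, hwb⟩ := step n g v hv
      refine ⟨w, hw.trans hv, hwb.trans ?_⟩
      have b2 : ‖v‖ ≤ |C| * ‖g‖ := hvb.trans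
        (mul_le_mul_of_nonneg_right (le_abs_self C) (norm_nonneg _))
      have b3 := mul_le_mul_of_nonneg_left (add_le_add_left b2 ‖g‖) (inv_pos.2 ha).le
      linarith
  have hN' : ∀ g, toL2 (N g) = toL2 (S (toL2 g)) := hN
  -- the equation holds for every Sobolev function agreeing with the variational solution
  have eqn : ∀ (g : Sobolev n) {k : ℕ} (w : Sobolev (k + 2)), toL2 w = toL2 (S (toL2 g)) →
      ∀ᵐ x ∂halfLine, w.fn x - μ / 3 * w.dx.dx.fn x = g.fn x := by
    intro g k w hw
    have h3 : toL2 w.dx.dx = (μ / 3)⁻¹ • (toL2 w - toL2 g) :=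
      w.dx.isWeakDeriv_dx.unique
        (by rw [toL2_dx_congr hw, hw]; exact isWeakDeriv_dx_of_energy ha (hS _))
    filter_upwards [Lp.coeFn_smul (μ / 3)⁻¹ (toL2 w - toL2 g), Lp.coeFn_sub (toL2 w) (toL2 g)]
      with x e1 e2
    rw [← h3, Pi.smul_apply, e2, Pi.sub_apply] at e1
    change w.dx.dx.fn x = (μ / 3)⁻¹ * (w.fn x - g.fn x) at e1
    rw [e1, mul_inv_cancel_left₀ ha.ne']
    ring
  refine ⟨N, fun g => ⟨fun G hG => ?_, eqn g _ (hN' g)⟩⟩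
  obtain ⟨v, hv, -⟩ := step 0 (ofL2 (toL2 g)) (S (toL2 g)) rfl
  have : SolvesNeumann μ G v := by
    refine ⟨?_, ?_⟩
    · filter_upwards [eqn g v hv, hG] with x e1 e2
      rw [e1, e2]
    · rw [trace_fn]
      exact rep_dx_eq_zero_of_energy ha (hS (toL2 g)) hv
  rw [this.eq_R₁ hμ, hv, hN']

end Sobolev

/-! ### Ordinary differential equations with locally Lipschitz vector fields -/

section ODE

variable {E : Type*} [NormedAddCommGroup E] [NormedSpace ℝ E] {V : ℝ → E → E} {U : Set E} {T : ℝ}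

/-- Local existence for a vector field on an open set that is continuous in time and locally
Lipschitz in space, uniformly in time. -/
theorem exists_solution_of_locallyLipschitz [CompleteSpace E] (hU : IsOpen U) (hT : 0 < T)
    (hV : ∀ x ∈ U, ∃ K, ∃ s ∈ 𝓝 x, ∀ t ∈ Icc 0 T, LipschitzOnWith K (V t) s)
    (hc : ∀ x ∈ U, ContinuousOn (V · x) (Icc 0 T)) {x₀ : E} (hx₀ : x₀ ∈ U) :
    ∃ T', 0 < T' ∧ T' ≤ T ∧ ∃ α : ℝ → E, α 0 = x₀ ∧
      ∀ t ∈ Icc 0 T', α t ∈ U ∧ HasDerivWithinAt α (V t (α t)) (Icc 0 T') t := by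
  obtain ⟨K, s, hs, hK⟩ := hV x₀ hx₀
  obtain ⟨r, hr, hrs⟩ := Metric.nhds_basis_closedBall.mem_iff.1 (inter_mem hs (hU.mem_nhds hx₀))
  obtain ⟨C, hC⟩ := isCompact_Icc.exists_bound_of_continuousOn (hc x₀ hx₀)
  have hC0 : 0 ≤ C := (norm_nonneg _).trans (hC 0 ⟨le_rfl, hT.le⟩)
  lift r to NNReal using hr.le
  lift C to NNReal using hC0
  have hr0 : (0 : ℝ) < r := hr
  set L : NNReal := C + K * r + 1 with hL
  have hLpos : (0 : ℝ) < L := by rw [hL]; positivity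
  set τ : ℝ := min T (r / L) with hτ
  have hτ0 : 0 < τ := lt_min hT (by positivity)
  have hτT : τ ≤ T := min_le_left _ _
  have hPL : IsPicardLindelof V (tmin := 0) (tmax := τ) ⟨0, le_rfl, hτ0.le⟩ x₀ r 0 L K := by
    refine ⟨fun t ht => ?_, fun x hx => ?_, fun t ht x hx => ?_, ?_⟩
    · exact (hK t ⟨ht.1, ht.2.trans hτT⟩).mono (hrs.trans inter_subset_left)
    · exact (hc x (hrs hx).2).mono (Icc_subset_Icc_right hτT)
    · have ht' : t ∈ Icc 0 T := ⟨ht.1, ht.2.trans hτT⟩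
      have h1 := (hK t ht').dist_le_mul x (hrs hx).1 x₀ (mem_of_mem_nhds hs)
      rw [dist_eq_norm] at h1
      have h2 : (K : ℝ) * dist x x₀ ≤ K * r :=
        mul_le_mul_of_nonneg_left (Metric.mem_closedBall.1 hx) K.2
      have h3 := norm_le_norm_add_norm_sub' (V t x) (V t x₀)
      have h4 := hC t ht'
      rw [hL]
      push_cast
      linarith
    · have h5 : (L : ℝ) * τ ≤ r := by
        have : τ ≤ r / L := min_le_right _ _
        rwa [le_div_iff₀ hLpos, mul_comm] at this
      simpa [hτ0.le] using h5
  obtain ⟨α, hα0, hα⟩ := hPL.exists_eq_forall_mem_Icc_hasDerivWithinAt₀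
  have hα0' : α 0 = x₀ := hα0
  -- the solution stays in `U` for a short time
  have hev : ∀ᶠ t in 𝓝[Icc 0 τ] 0, α t ∈ U :=
    (hα 0 ⟨le_rfl, hτ0.le⟩).continuousWithinAt.eventually (hα0'.symm ▸ hU.mem_nhds hx₀)
  rw [nhdsWithin_Icc_eq_nhdsGE hτ0] at hev
  obtain ⟨d, hd, hdU⟩ := mem_nhdsGE_iff_exists_Icc_subset.1 hev
  have hd : (0 : ℝ) < d := hd
  refine ⟨min τ d, lt_min hτ0 hd, (min_le_left _ _).trans hτT, α, hα0', fun t ht => ⟨?_, ?_⟩⟩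
  · exact hdU ⟨ht.1, ht.2.trans (min_le_right _ _)⟩
  · exact (hα t ⟨ht.1, ht.2.trans (min_le_left _ _)⟩).mono
      (Icc_subset_Icc_right (min_le_left _ _))

/-- Uniqueness for such vector fields: by local uniqueness, the closed set of times at which two
solutions agree extends to the right of each of its points. -/
theorem eqOn_of_locallyLipschitz
    (hV : ∀ x ∈ U, ∃ K, ∃ s ∈ 𝓝 x, ∀ t ∈ Icc 0 T, LipschitzOnWith K (V t) s)
    {α β : ℝ → E} (h0 : α 0 = β 0)
    (hα : ∀ t ∈ Icc 0 T, α t ∈ U ∧ HasDerivWithinAt α (V t (α t)) (Icc 0 T) t)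
    (hβ : ∀ t ∈ Icc 0 T, HasDerivWithinAt β (V t (β t)) (Icc 0 T) t) :
    EqOn α β (Icc 0 T) := by
  have cα : ContinuousOn α (Icc 0 T) := fun t ht => (hα t ht).2.continuousWithinAt
  have cβ : ContinuousOn β (Icc 0 T) := fun t ht => (hβ t ht).continuousWithinAt
  have hcl : IsClosed ({t | α t = β t} ∩ Icc 0 T) := by
    have := (cα.prodMk cβ).preimage_isClosed_of_isClosed isClosed_Icc isClosed_diagonal
    rw [inter_comm]
    exact this
  refine fun t ht => hcl.Icc_subset_of_forall_mem_nhdsWithin h0 ?_ ht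
  rintro a ⟨hab, ha0, haT⟩
  have hab : α a = β a := hab
  have haI : a ∈ Icc 0 T := ⟨ha0, haT.le⟩
  obtain ⟨K, s, hs, hK⟩ := hV (α a) (hα a haI).1
  have hs' : s ∈ 𝓝 (β a) := hab ▸ hs
  have hnh : 𝓝[Icc 0 T] a ≥ 𝓝[≥] a :=
    nhdsWithin_le_iff.2 (mem_of_superset (Icc_mem_nhdsGE haT) (Icc_subset_Icc_left ha0))
  have e1 : ∀ᶠ t in 𝓝[≥] a, α t ∈ s := ((cα a haI).eventually hs).filter_mono hnh
  have e2 : ∀ᶠ t in 𝓝[≥] a, β t ∈ s := ((cβ a haI).eventually hs').filter_mono hnh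
  have e3 : ∀ᶠ t in 𝓝[≥] a, t ∈ Icc a T := Icc_mem_nhdsGE haT
  obtain ⟨d, hd, hsub⟩ := mem_nhdsGE_iff_exists_Icc_subset.1 (e1.and (e2.and e3))
  have hd : a < d := hd
  have hI : ∀ t ∈ Ico a d, t ∈ Icc 0 T := fun t ht =>
    ⟨ha0.trans ht.1, (hsub (Ico_subset_Icc_self ht)).2.2.2⟩
  have hsubI : Icc a d ⊆ Icc 0 T := fun t ht => ⟨ha0.trans ht.1, (hsub ht).2.2.2⟩
  have hlt : ∀ t ∈ Ico a d, t < T := fun t ht =>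
    ht.2.trans_le (hsub ⟨hd.le, le_rfl⟩).2.2.2
  have hnb : ∀ t ∈ Ico a d, Icc 0 T ∈ 𝓝[≥] t := fun t ht =>
    mem_of_superset (Icc_mem_nhdsGE (hlt t ht)) (Icc_subset_Icc_left (ha0.trans ht.1))
  have key : EqOn α β (Icc a d) := by
    refine ODE_solution_unique_of_mem_Icc_right (v := V) (s := fun _ => s) (K := K)
      (fun t ht => hK t (hI t ht)) (cα.mono hsubI) (fun t ht => ?_)
      (fun t ht => (hsub (Ico_subset_Icc_self ht)).1) (cβ.mono hsubI) (fun t ht => ?_)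
      (fun t ht => (hsub (Ico_subset_Icc_self ht)).2.1) hab
    · exact (hα t (hI t ht)).2.mono_of_mem_nhdsWithin (hnb t ht)
    · exact (hβ t (hI t ht)).mono_of_mem_nhdsWithin (hnb t ht)
  exact mem_of_superset (Icc_mem_nhdsGT hd) key

end ODE

/-- `A` is Lipschitz in a neighbourhood of `x`. -/
def LipNear {E F : Type*} [PseudoEMetricSpace E] [PseudoEMetricSpace F] (A : E → F) (x : E) :
    Prop :=
  ∃ K, ∃ s ∈ 𝓝 x, LipschitzOnWith K A s

namespace LipNear

variable {E F G : Type*} [PseudoEMetricSpace E] [PseudoEMetricSpace F] [PseudoEMetricSpace G]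

theorem continuousAt {A : E → F} {x : E} (h : LipNear A x) : ContinuousAt A x := by
  obtain ⟨K, s, hs, hK⟩ := h
  exact hK.continuousOn.continuousAt hs

theorem comp {A : E → F} {B : F → G} {x : E} (hB : LipNear B (A x)) (hA : LipNear A x) :
    LipNear (fun y => B (A y)) x := by
  have hc := hA.continuousAt
  obtain ⟨K, s, hs, hK⟩ := hB
  obtain ⟨K', s', hs', hK'⟩ := hA
  refine ⟨K * K', s' ∩ A ⁻¹' s, inter_mem hs' (hc hs), ?_⟩
  exact hK.comp (hK'.mono inter_subset_left) fun y hy => hy.2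

theorem prodMk {A : E → F} {B : E → G} {x : E} (hA : LipNear A x) (hB : LipNear B x) :
    LipNear (fun y => (A y, B y)) x := by
  obtain ⟨K, s, hs, hK⟩ := hA
  obtain ⟨K', s', hs', hK'⟩ := hB
  exact ⟨max K K', s ∩ s', inter_mem hs hs',
    (hK.mono inter_subset_left).prodMk (hK'.mono inter_subset_right)⟩

end LipNear

theorem LipNear.of_contDiff {E F : Type*} [NormedAddCommGroup E] [NormedSpace ℝ E]
    [NormedAddCommGroup F] [NormedSpace ℝ F] {A : E → F} (h : ContDiff ℝ 1 A) (x : E) :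
    LipNear A x :=
  h.contDiffAt.exists_lipschitzOnWith

namespace Sobolev

variable {n : ℕ} {ε : ℝ}

/-! ### The flux as a locally Lipschitz map -/

open Classical in
/-- `1 / (1 + ε ζ) - 1`, as an element of `Hⁿ⁺¹` (and `0` if `1 + ε ζ` is not bounded below). -/
def recip (ε : ℝ) (ζ : Sobolev (n + 1)) : Sobolev (n + 1) :=
  if h : PositiveDepth ε ζ.fn then (exists_recip n ζ h).choose else 0

theorem recip_spec {ζ : Sobolev (n + 1)} (h : PositiveDepth ε ζ.fn) :
    ∀ᵐ x ∂halfLine, (1 + ε * ζ.fn x) * (1 + (recip ε ζ).fn x) = 1 := by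
  rw [recip, dif_pos h]
  exact (exists_recip n ζ h).choose_spec

theorem isOpen_positiveDepth (ε : ℝ) : IsOpen {ζ : Sobolev (n + 1) | PositiveDepth ε ζ.fn} := by
  rw [isOpen_iff_mem_nhds]
  rintro ζ ⟨c, hc, h⟩
  have hcont : Continuous fun ζ' : Sobolev (n + 1) => |ε| * ‖ζ' - ζ‖ := by fun_prop
  have hev : ∀ᶠ ζ' in 𝓝 ζ, |ε| * ‖ζ' - ζ‖ < c / 2 :=
    hcont.continuousAt.eventually_lt continuousAt_const (by simpa using hc)
  filter_upwards [hev] with ζ' hζ'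
  refine ⟨c / 2, by positivity, ?_⟩
  filter_upwards [h, (ζ' - ζ).ae_abs_fn_le, fn_sub ζ' ζ] with x h1 h2 h3
  rw [h3] at h2
  have h4 : |ε * (ζ'.fn x - ζ.fn x)| ≤ |ε| * ‖ζ' - ζ‖ := by
    rw [abs_mul]
    exact mul_le_mul_of_nonneg_left h2 (abs_nonneg _)
  have h5 := (abs_le.1 (h4.trans hζ'.le)).1
  linarith

/-- The resolvent identity for reciprocals. -/
theorem recip_sub_recip {ζ ζ' : Sobolev (n + 1)} (h : PositiveDepth ε ζ.fn)
    (h' : PositiveDepth ε ζ'.fn) :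
    recip ε ζ' - recip ε ζ = (-ε) • ((ζ' - ζ + mulL (ζ' - ζ) (recip ε ζ)) +
      mulL (ζ' - ζ + mulL (ζ' - ζ) (recip ε ζ)) (recip ε ζ')) := by
  refine ext_fn ?_
  set D := ζ' - ζ with hD
  set P := mulL D (recip ε ζ) with hP
  filter_upwards [fn_sub (recip ε ζ') (recip ε ζ), fn_smul (-ε) (D + P + mulL (D + P) (recip ε ζ')),
    fn_add (D + P) (mulL (D + P) (recip ε ζ')), fn_add D P, fn_mulL (D + P) (recip ε ζ'),
    fn_mulL D (recip ε ζ), fn_sub ζ' ζ, recip_spec h, recip_spec h'] with x e1 e2 e3 e4 e5 e6 e7 r r'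
  rw [e1, e2, e3, e5, e4, hP, e6, hD, e7]
  generalize (recip ε ζ).fn x = a at *
  generalize (recip ε ζ').fn x = b at *
  linear_combination (1 + a) * r' - (1 + b) * r

theorem norm_recip_sub_le {c : ℝ} (hc0 : 0 ≤ c)
    (hc : ∀ u v : Sobolev (n + 1), ‖mulL u v‖ ≤ c * ‖u‖ * ‖v‖) {ζ ζ' : Sobolev (n + 1)}
    (h : PositiveDepth ε ζ.fn) (h' : PositiveDepth ε ζ'.fn) :
    ‖recip ε ζ' - recip ε ζ‖ ≤
      |ε| * (‖ζ' - ζ‖ * (1 + c * ‖recip ε ζ‖) * (1 + c * ‖recip ε ζ'‖)) := by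
  have key : ∀ u v : Sobolev (n + 1), ‖u + mulL u v‖ ≤ ‖u‖ * (1 + c * ‖v‖) := by
    intro u v
    have h1 := hc u v
    have h2 := norm_add_le u (mulL u v)
    linarith
  rw [recip_sub_recip h h', norm_smul, Real.norm_eq_abs, abs_neg]
  refine mul_le_mul_of_nonneg_left ((key _ _).trans ?_) (abs_nonneg _)
  exact mul_le_mul_of_nonneg_right (key _ _) (by positivity)

/-- The resolvent identity bounds `‖recip ε ζ'‖` for `ζ'` near `ζ`, and then yields the Lipschitz
estimate. -/
theorem lipNear_recip {ζ : Sobolev (n + 1)} (h : PositiveDepth ε ζ.fn) :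
    LipNear (recip ε) ζ := by
  obtain ⟨c, hc0, hc⟩ := exists_norm_mulL_le n
  set M := 1 + c * ‖recip ε ζ‖ with hM
  have hM0 : 0 < M := by positivity
  set R := 2 * ‖recip ε ζ‖ + 1 with hR
  have hR0 : 0 < R := by positivity
  have hcont : Continuous fun ζ' : Sobolev (n + 1) => |ε| * (‖ζ' - ζ‖ * M) * (1 + c) := by
    fun_prop
  have hev : ∀ᶠ ζ' in 𝓝 ζ, |ε| * (‖ζ' - ζ‖ * M) * (1 + c) < 1 / 2 :=
    hcont.continuousAt.eventually_lt continuousAt_const (by simp)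
  have hbd : ∀ ζ' : Sobolev (n + 1), PositiveDepth ε ζ'.fn →
      |ε| * (‖ζ' - ζ‖ * M) * (1 + c) < 1 / 2 → ‖recip ε ζ'‖ ≤ R := by
    intro ζ' h1 h2
    have h3 := norm_recip_sub_le hc0 hc h h1
    have h4 := norm_le_norm_add_norm_sub' (recip ε ζ') (recip ε ζ)
    set e := |ε| * (‖ζ' - ζ‖ * M) with he
    have he0 : 0 ≤ e := by positivity
    have h5 : ‖recip ε ζ' - recip ε ζ‖ ≤ e + e * c * ‖recip ε ζ'‖ := by
      refine h3.trans_eq ?_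
      rw [he, hM]
      ring
    have h6 : e * c ≤ 1 / 2 := by nlinarith
    have h7 : e ≤ 1 / 2 := by nlinarith
    have h8 : e * c * ‖recip ε ζ'‖ ≤ 1 / 2 * ‖recip ε ζ'‖ :=
      mul_le_mul_of_nonneg_right h6 (norm_nonneg _)
    rw [hR]
    linarith
  refine ⟨(|ε| * ((1 + c * R) * (1 + c * R))).toNNReal, _,
    inter_mem ((isOpen_positiveDepth ε).mem_nhds h) hev, ?_⟩
  refine LipschitzOnWith.of_dist_le_mul fun ζ₁ h₁ ζ₂ h₂ => ?_
  rw [Real.coe_toNNReal _ (by positivity), dist_eq_norm, dist_eq_norm]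
  refine (norm_recip_sub_le hc0 hc h₂.1 h₁.1).trans ?_
  have b₁ := mul_le_mul_of_nonneg_left (hbd ζ₁ h₁.1 h₁.2) hc0
  have b₂ := mul_le_mul_of_nonneg_left (hbd ζ₂ h₂.1 h₂.2) hc0
  rw [mul_assoc |ε|, mul_assoc, mul_comm ‖ζ₁ - ζ₂‖]
  refine mul_le_mul_of_nonneg_left (mul_le_mul_of_nonneg_right ?_ (norm_nonneg _)) (abs_nonneg _)
  exact mul_le_mul (by linarith) (by linarith) (by positivity) (by positivity)

/-- The flux `ζ + (ε/2) ζ² + ε q² / (1 + ε ζ)` as an element of `Hⁿ⁺¹`. -/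
def fluxS (ε : ℝ) (x : Sobolev (n + 1) × Sobolev (n + 2)) : Sobolev (n + 1) :=
  x.1 + (ε / 2) • mulL x.1 x.1 + ε • (mulL (incl x.2) (incl x.2) +
    mulL (mulL (incl x.2) (incl x.2)) (recip ε x.1))

theorem fn_fluxS (hε : ε ≠ 0) {x : Sobolev (n + 1) × Sobolev (n + 2)}
    (h : PositiveDepth ε x.1.fn) : flux ε x.1.fn x.2.fn =ᵐ[halfLine] (fluxS ε x).fn := by
  obtain ⟨c, hc, h1⟩ := id h
  set q := incl x.2 with hq
  have hqfn : q.fn = x.2.fn := fn_incl _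
  unfold fluxS
  rw [← hq, ← hqfn]
  filter_upwards [h1, recip_spec h, fn_mulL x.1 x.1, fn_mulL q q, fn_mulL (mulL q q) (recip ε x.1),
    fn_smul (ε / 2) (mulL x.1 x.1), fn_add x.1 ((ε / 2) • mulL x.1 x.1),
    fn_add (mulL q q) (mulL (mulL q q) (recip ε x.1)),
    fn_smul ε (mulL q q + mulL (mulL q q) (recip ε x.1)),
    fn_add (x.1 + (ε / 2) • mulL x.1 x.1) (ε • (mulL q q + mulL (mulL q q) (recip ε x.1)))]
    with y hy e1 e2 e3 e4 e5 e6 e7 e8 e9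
  rw [e9, e6, e5, e8, e7, e4, e3, e2]
  have h0 : 1 + ε * x.1.fn y ≠ 0 := (hc.trans_le hy).ne'
  have e10 : 1 / (1 + ε * x.1.fn y) = 1 + (recip ε x.1).fn y := by
    rw [eq_comm, eq_div_iff h0, mul_comm]
    exact e1
  unfold flux
  rw [e10]
  field_simp
  ring

theorem lipNear_fluxS {x : Sobolev (n + 1) × Sobolev (n + 2)} (h : PositiveDepth ε x.1.fn) :
    LipNear (fluxS ε) x := by
  let P : (Sobolev (n + 1) × Sobolev (n + 2)) × Sobolev (n + 1) → Sobolev (n + 1) := fun y =>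
    y.1.1 + (ε / 2) • mulL y.1.1 y.1.1 + ε • (mulL (incl y.1.2) (incl y.1.2) +
      mulL (mulL (incl y.1.2) (incl y.1.2)) y.2)
  have hP : ContDiff ℝ 1 P := by fun_prop
  have h1 : LipNear (fun y : Sobolev (n + 1) × Sobolev (n + 2) => (y, recip ε y.1)) x :=
    (LipNear.of_contDiff contDiff_id x).prodMk
      (LipNear.comp (A := Prod.fst) (lipNear_recip h) (LipNear.of_contDiff contDiff_fst x))
  exact LipNear.comp (A := fun y : Sobolev (n + 1) × Sobolev (n + 2) => (y, recip ε y.1))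
    (LipNear.of_contDiff hP _) h1

end Sobolev

/-! ### The system as an ordinary differential equation -/

/-- Time-dependent coefficients that are bounded on `I` keep Lipschitz estimates uniform. -/
theorem LipNear.exists_uniform {E F : Type*} [PseudoEMetricSpace E] [NormedAddCommGroup F]
    [NormedSpace ℝ F] {A B : E → F} {x : E} (hA : LipNear A x) (hB : LipNear B x) {a : ℝ → ℝ}
    {I : Set ℝ} {M : ℝ} (ha : ∀ t ∈ I, ‖a t‖ ≤ M) (b : ℝ → F) :
    ∃ K, ∃ s ∈ 𝓝 x, ∀ t ∈ I, LipschitzOnWith K (fun y => A y + a t • B y + b t) s := by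
  obtain ⟨K, s, hs, hK⟩ := hA
  obtain ⟨K', s', hs', hK'⟩ := hB
  refine ⟨K + M.toNNReal * K', s ∩ s', inter_mem hs hs', fun t ht => ?_⟩
  have h1 : ‖a t‖₊ ≤ M.toNNReal := by
    rw [← NNReal.coe_le_coe]
    exact (ha t ht).trans (Real.le_coe_toNNReal M)
  have h2 : LipschitzOnWith (M.toNNReal * K') (fun y => a t • B y) s' :=
    ((lipschitzWith_smul (a t)).comp_lipschitzOnWith hK').weaken (mul_le_mul_left h1 _)
  have h3 := (hK.mono inter_subset_left).add (h2.mono (inter_subset_right (s := s)))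
  have h4 := h3.add ((LipschitzWith.const (b t)).lipschitzOnWith (s := s ∩ s'))
  rwa [add_zero] at h4

section Prod

variable {E F : Type*} [NormedAddCommGroup E] [NormedSpace ℝ E] [NormedAddCommGroup F]
  [NormedSpace ℝ F] {α : ℝ → E × F} {v : E × F} {s : Set ℝ} {t : ℝ}

theorem hasDerivWithinAt_fst (h : HasDerivWithinAt α v s t) :
    HasDerivWithinAt (fun t => (α t).1) v.1 s t :=
  (ContinuousLinearMap.fst ℝ E F).hasFDerivAt.comp_hasDerivWithinAt t h

theorem hasDerivWithinAt_snd (h : HasDerivWithinAt α v s t) :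
    HasDerivWithinAt (fun t => (α t).2) v.2 s t :=
  (ContinuousLinearMap.snd ℝ E F).hasFDerivAt.comp_hasDerivWithinAt t h

end Prod

namespace Sobolev

variable {m : ℕ} {ε μ : ℝ}

/-- The right-hand side of the system, for `x = (ζ, q)` and `f₀, f₂` the values of `f` and of its
second derivative; `N` stands for the Neumann solution operator `Hᵐ⁺¹ → Hᵐ⁺³` and `e` for the
boundary layer `exp (-x / δ)`. -/
def evolution (ε μ f₀ f₂ : ℝ) (N : Sobolev (m + 1) →L[ℝ] Sobolev (m + 3)) (e : Sobolev (m + 2))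
    (x : Sobolev (m + 1) × Sobolev (m + 2)) : Sobolev (m + 1) × Sobolev (m + 2) :=
  (-dxL x.2, -dxL (N (fluxS ε x)) +
    (ε / δ μ * (traceL x.2 ^ 2 / (1 + ε * f₀)) + δ μ * f₂ + 1 / δ μ * (1 + ε / 2 * f₀) * f₀
      - 1 / δ μ * traceL (N (fluxS ε x))) • e)

/-- `N` is the Neumann solution operator, with values in `Hⁿ⁺²`. -/
def IsNeumannOp (μ : ℝ) {n : ℕ} (N : Sobolev n →L[ℝ] Sobolev (n + 2)) : Prop :=
  ∀ g, (∀ G : ℝ → ℝ, G =ᵐ[halfLine] g.fn → toL2 (R₁ μ G) = toL2 (N g)) ∧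
    ∀ᵐ x ∂halfLine, (N g).fn x - μ / 3 * (N g).dx.dx.fn x = g.fn x

variable {N : Sobolev (m + 1) →L[ℝ] Sobolev (m + 3)} {e : Sobolev (m + 2)}

/-- The momentum equation, an equality of functions, is an equality in `Hᵐ⁺²`. -/
theorem momentum_iff (hε : ε ≠ 0) (hN : IsNeumannOp μ N)
    (he : e.fn =ᵐ[halfLine] fun x => Real.exp (-x / δ μ))
    {x : Sobolev (m + 1) × Sobolev (m + 2)} (hx : PositiveDepth ε x.1.fn) (f₀ f₂ : ℝ)
    (p : Sobolev (m + 2)) :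
    (∀ᵐ y ∂halfLine, p.fn y + (R₁ μ (flux ε x.1.fn x.2.fn)).dx.fn y =
      Q ε μ (trace x.2.fn) f₀ f₂ x.1.fn x.2.fn * Real.exp (-y / δ μ)) ↔
    p = (evolution ε μ f₀ f₂ N e x).2 := by
  have h1 : toL2 (R₁ μ (flux ε x.1.fn x.2.fn)) = toL2 (N (fluxS ε x)) :=
    (hN (fluxS ε x)).1 _ (fn_fluxS hε hx)
  have h2 : (R₁ μ (flux ε x.1.fn x.2.fn)).dx.fn = (N (fluxS ε x)).dx.fn :=
    fn_congr (toL2_dx_congr h1)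
  have h3 : R₁bdry μ (flux ε x.1.fn x.2.fn) = traceL (N (fluxS ε x)) := by
    rw [R₁bdry, fn_congr h1, trace_eq_traceL]
  unfold Q
  rw [h2, h3, trace_eq_traceL]
  unfold evolution
  set c := ε / δ μ * (traceL x.2 ^ 2 / (1 + ε * f₀)) + δ μ * f₂ + 1 / δ μ * (1 + ε / 2 * f₀) * f₀
      - 1 / δ μ * traceL (N (fluxS ε x))
  have h4 : (-dxL (N (fluxS ε x)) + c • e).fn =ᵐ[halfLine]
      fun y => -(N (fluxS ε x)).dx.fn y + c * Real.exp (-y / δ μ) := by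
    filter_upwards [fn_add (-dxL (N (fluxS ε x))) (c • e), fn_neg (dxL (N (fluxS ε x))),
      fn_smul c e, he] with y e1 e2 e3 e4
    rw [e1, e2, e3, e4, dxL_apply]
  constructor
  · intro h
    refine ext_fn ?_
    filter_upwards [h, h4] with y e1 e2
    rw [e2]
    linarith
  · rintro rfl
    filter_upwards [h4] with y e1
    change (-dxL (N (fluxS ε x)) + c • e).fn y + _ = _
    rw [e1]
    ring

/-- `evolution` is locally Lipschitz, uniformly in time. It has the form
`A(x) + a(t) B(x) + b(t)`, where `B` is the quadratic term with the trace of `q`. -/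
theorem exists_lipschitzOnWith_evolution {f f₂ : ℝ → ℝ} {T : ℝ}
    (hf : ContinuousOn f (Icc 0 T)) (hf0 : ∀ t ∈ Icc 0 T, 1 + ε * f t ≠ 0)
    {x : Sobolev (m + 1) × Sobolev (m + 2)} (hx : PositiveDepth ε x.1.fn) :
    ∃ K, ∃ s ∈ 𝓝 x, ∀ t ∈ Icc 0 T,
      LipschitzOnWith K (evolution ε μ (f t) (f₂ t) N e) s := by
  let A₀ : (Sobolev (m + 1) × Sobolev (m + 2)) × Sobolev (m + 1) →
      Sobolev (m + 1) × Sobolev (m + 2) := fun y =>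
    (-dxL y.1.2, -dxL (N y.2) + (-(1 / δ μ * traceL (N y.2))) • e)
  let B : Sobolev (m + 1) × Sobolev (m + 2) → Sobolev (m + 1) × Sobolev (m + 2) := fun y =>
    (0, traceL y.2 ^ 2 • e)
  have hA₀ : ContDiff ℝ 1 A₀ := by fun_prop
  have hB : ContDiff ℝ 1 B := by fun_prop
  have hA : LipNear (fun y => A₀ (y, fluxS ε y)) x :=
    LipNear.comp (A := fun y : Sobolev (m + 1) × Sobolev (m + 2) => (y, fluxS ε y))
      (LipNear.of_contDiff hA₀ _) ((LipNear.of_contDiff contDiff_id x).prodMk (lipNear_fluxS hx))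
  have ha : ContinuousOn (fun t => ε / δ μ * (1 + ε * f t)⁻¹) (Icc 0 T) :=
    continuousOn_const.mul
      ((continuousOn_const.add (continuousOn_const.mul hf)).inv₀ hf0)
  obtain ⟨M, hM⟩ := isCompact_Icc.exists_bound_of_continuousOn ha
  obtain ⟨K, s, hs, hK⟩ := hA.exists_uniform (LipNear.of_contDiff hB x) hM fun t =>
    ((0, (δ μ * f₂ t + 1 / δ μ * (1 + ε / 2 * f t) * f t) • e) :
      Sobolev (m + 1) × Sobolev (m + 2))
  refine ⟨K, s, hs, fun t ht => ?_⟩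
  have key : ∀ (v w : Sobolev (m + 2)) (a b c d k : ℝ), k = a + b * c + d →
      v + k • w = v + a • w + b • c • w + d • w := by
    rintro v w a b c d k rfl
    rw [add_smul, add_smul, mul_smul]
    abel
  have hfun : evolution ε μ (f t) (f₂ t) N e = fun y => A₀ (y, fluxS ε y) +
      (ε / δ μ * (1 + ε * f t)⁻¹) • B y +
      (0, (δ μ * f₂ t + 1 / δ μ * (1 + ε / 2 * f t) * f t) • e) := by
    funext y
    refine Prod.ext ?_ ?_
    · change -dxL y.2 = -dxL y.2 + (ε / δ μ * (1 + ε * f t)⁻¹) • (0 : Sobolev (m + 1)) + 0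
      rw [smul_zero, add_zero, add_zero]
    · refine key _ _ _ _ _ _ _ ?_
      rw [div_eq_mul_inv (traceL y.2 ^ 2)]
      ring
  rw [hfun]
  exact hK t ht

theorem continuousOn_evolution {f f₂ : ℝ → ℝ} {T : ℝ}
    (hf : ContinuousOn f (Icc 0 T)) (hf₂ : ContinuousOn f₂ (Icc 0 T))
    (hf0 : ∀ t ∈ Icc 0 T, 1 + ε * f t ≠ 0) {α : ℝ → Sobolev (m + 1) × Sobolev (m + 2)}
    (hα : ContinuousOn α (Icc 0 T)) (hd : ∀ t ∈ Icc 0 T, PositiveDepth ε (α t).1.fn) :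
    ContinuousOn (fun t => evolution ε μ (f t) (f₂ t) N e (α t)) (Icc 0 T) := by
  have hF : ContinuousOn (fun t => fluxS ε (α t)) (Icc 0 T) := fun t ht =>
    (lipNear_fluxS (hd t ht)).continuousAt.comp_continuousWithinAt (hα t ht)
  have hN : ContinuousOn (fun t => N (fluxS ε (α t))) (Icc 0 T) := N.continuous.comp_continuousOn hF
  have h2 : ContinuousOn (fun t => (α t).2) (Icc 0 T) := continuous_snd.comp_continuousOn hα
  have h3 : ContinuousOn (fun t => traceL (α t).2) (Icc 0 T) :=
    traceL.continuous.comp_continuousOn h2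
  have h4 : ContinuousOn (fun t => traceL (N (fluxS ε (α t)))) (Icc 0 T) :=
    traceL.continuous.comp_continuousOn hN
  have h5 : ContinuousOn (fun t => 1 + ε * f t) (Icc 0 T) :=
    continuousOn_const.add (continuousOn_const.mul hf)
  have h6 : ContinuousOn (fun t => 1 + ε / 2 * f t) (Icc 0 T) :=
    continuousOn_const.add (continuousOn_const.mul hf)
  refine (dxL.continuous.comp_continuousOn h2).neg.prodMk
    ((dxL.continuous.comp_continuousOn hN).neg.add (ContinuousOn.fun_smul ?_ continuousOn_const))
  exact ((((continuousOn_const.mul ((h3.pow 2).div h5 hf0)).add (continuousOn_const.mul hf₂)).add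
    ((continuousOn_const.mul h6).mul hf)).sub (continuousOn_const.mul h4))

theorem _root_.AbbottBoussinesq.IsSolution.hasDerivWithinAt {f : ℝ → ℝ} {T : ℝ} (hε : ε ≠ 0)
    (hN : IsNeumannOp μ N) (he : e.fn =ᵐ[halfLine] fun x => Real.exp (-x / δ μ))
    {ζ0 : Sobolev (m + 1)} {q0 : Sobolev (m + 2)} {ζ : ℝ → Sobolev (m + 1)}
    {q : ℝ → Sobolev (m + 2)} (h : IsSolution ε μ f ζ0 q0 T ζ q) {t : ℝ} (ht : t ∈ Icc 0 T) :
    HasDerivWithinAt (fun t => (ζ t, q t))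
      (evolution ε μ (f t) (iteratedDerivWithin 2 f (Ici 0) t) N e (ζ t, q t)) (Icc 0 T) t := by
  have h1 := (h.contDiff_ζ.differentiableOn one_ne_zero t ht).hasDerivWithinAt
  have h2 := (h.contDiff_q.differentiableOn one_ne_zero t ht).hasDerivWithinAt
  rw [(momentum_iff hε hN he (x := (ζ t, q t)) (h.depth t ht) _ _ _).1 (h.momentum t ht)] at h2
  rw [eq_neg_of_add_eq_zero_left (h.mass t ht)] at h1
  exact h1.prodMk h2

theorem isSolution_of_hasDerivWithinAt {f : ℝ → ℝ} {T : ℝ} (hT : 0 < T)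
    (hε : ε ≠ 0) (hN : IsNeumannOp μ N) (he : e.fn =ᵐ[halfLine] fun x => Real.exp (-x / δ μ))
    (hf : ContDiffOn ℝ 2 f (Ici 0)) (hf0 : ∀ t ∈ Icc 0 T, 1 + ε * f t ≠ 0)
    {α : ℝ → Sobolev (m + 1) × Sobolev (m + 2)}
    (hα : ∀ t ∈ Icc 0 T, PositiveDepth ε (α t).1.fn ∧ HasDerivWithinAt α
      (evolution ε μ (f t) (iteratedDerivWithin 2 f (Ici 0) t) N e (α t)) (Icc 0 T) t) :
    IsSolution ε μ f (α 0).1 (α 0).2 T (fun t => (α t).1) (fun t => (α t).2) := by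
  have hu := uniqueDiffOn_Icc hT
  have hc : ContinuousOn α (Icc 0 T) := fun t ht => (hα t ht).2.continuousWithinAt
  have hsub : Icc 0 T ⊆ Ici 0 := Icc_subset_Ici_self
  have hev := continuousOn_evolution (μ := μ) (N := N) (e := e) (hf.continuousOn.mono hsub)
    ((hf.continuousOn_iteratedDerivWithin le_rfl (uniqueDiffOn_Ici 0)).mono hsub) hf0 hc
    fun t ht => (hα t ht).1
  have hcd : ContDiffOn ℝ 1 α (Icc 0 T) := by
    rw [contDiffOn_one_iff_derivWithin hu]
    refine ⟨fun t ht => (hα t ht).2.differentiableWithinAt, hev.congr fun t ht => ?_⟩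
    exact (hα t ht).2.derivWithin (hu t ht)
  have d1 : ∀ t ∈ Icc 0 T, derivWithin (fun t => (α t).1) (Icc 0 T) t = -dxL (α t).2 :=
    fun t ht => (hasDerivWithinAt_fst (hα t ht).2).derivWithin (hu t ht)
  have d2 : ∀ t ∈ Icc 0 T, derivWithin (fun t => (α t).2) (Icc 0 T) t =
      (evolution ε μ (f t) (iteratedDerivWithin 2 f (Ici 0) t) N e (α t)).2 :=
    fun t ht => (hasDerivWithinAt_snd (hα t ht).2).derivWithin (hu t ht)
  refine ⟨contDiff_fst.comp_contDiffOn hcd, contDiff_snd.comp_contDiffOn hcd, rfl, rfl,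
    fun t ht => (hα t ht).1, hf0, fun t ht => ?_, fun t ht => ?_⟩
  · rw [d1 t ht, dxL_apply, neg_add_cancel]
  · exact (momentum_iff hε hN he (hα t ht).1 _ _ _).2 (d2 t ht)

/-! ### Propagation of the boundary condition -/

theorem traceL_incl (u : Sobolev (m + 2)) : traceL (incl u) = traceL u := by
  rw [← trace_eq_traceL, ← trace_eq_traceL, fn_incl]

theorem traceL_fluxS (x : Sobolev (m + 1) × Sobolev (m + 2)) :
    traceL (fluxS ε x) = traceL x.1 + ε / 2 * traceL x.1 ^ 2 +
      ε * traceL x.2 ^ 2 * (1 + traceL (recip ε x.1)) := by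
  have hm : ∀ u v : Sobolev (m + 1), traceL (mulL u v) = traceL u * traceL v := fun u v =>
    rep_mulL u v self_mem_Ici
  unfold fluxS
  rw [map_add, map_add, map_smul, map_smul, map_add, hm, hm, hm, hm, traceL_incl, smul_eq_mul,
    smul_eq_mul]
  ring

theorem traceL_recip {ζ : Sobolev (m + 1)} (h : PositiveDepth ε ζ.fn) :
    (1 + ε * traceL ζ) * (1 + traceL (recip ε ζ)) = 1 := by
  have h1 := eqOn_Ici_of_ae_eq
    (r := fun x => (1 + ε * ζ.rep x) * (1 + (recip ε ζ).rep x)) (s := fun _ => 1)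
    ((continuousOn_const.add (continuousOn_const.mul ζ.isLocAC_rep.continuousOn)).mul
      (continuousOn_const.add (recip ε ζ).isLocAC_rep.continuousOn)) continuousOn_const (by
        filter_upwards [recip_spec h, ζ.rep_ae_eq, (recip ε ζ).rep_ae_eq] with x e1 e2 e3
        rw [e2, e3, e1])
  exact h1 self_mem_Ici

theorem traceL_dx_exp {d : ℝ} (he : e.fn =ᵐ[halfLine] fun x => Real.exp (-x / d)) :
    traceL (dxL e) = -1 / d := by
  have hcd : ContDiff ℝ 1 fun x => Real.exp (-x / d) := by fun_prop
  have hder : ∀ x, deriv (fun x => Real.exp (-x / d)) x = Real.exp (-x / d) * (-1 / d) :=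
    fun x => (((hasDerivAt_id x).neg.div_const d).exp).deriv
  have h1 := e.isLocAC_rep.ae_eq_of_eqOn (IsLocAC.of_contDiff hcd)
    (rep_eqOn hcd.continuous.continuousOn he.symm)
  have h2 := rep_eqOn (u := e.dx) (hcd.continuous_deriv le_rfl).continuousOn h1.symm self_mem_Ici
  rw [dxL_apply, traceL_apply, h2, hder]
  simp

theorem traceL_dx_dx_neumann (hμ : 0 < μ) (hN : IsNeumannOp μ N) (g : Sobolev (m + 1)) :
    traceL (dxL (dxL (N g))) = (μ / 3)⁻¹ * (traceL (N g) - traceL g) := by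
  have h1 : dxL (dxL (N g)) = (μ / 3)⁻¹ • (incl (incl (N g)) - g) := by
    refine ext_fn ?_
    filter_upwards [(hN g).2, fn_smul (μ / 3)⁻¹ (incl (incl (N g)) - g),
      fn_sub (incl (incl (N g))) g] with x e1 e2 e3
    rw [e2, e3, fn_incl, fn_incl, dxL_apply, dxL_apply, ← e1]
    field_simp
    ring
  rw [h1, map_smul, map_sub, traceL_incl, traceL_incl, smul_eq_mul]

/-- The second time derivative of `ζ(t, 0) - f(t)` is a multiple of `ζ(t, 0) - f(t)`: the
amplitude of the boundary layer is chosen to this end. -/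
theorem traceL_dx_evolution (hμ : 0 < μ) (hN : IsNeumannOp μ N)
    (he : e.fn =ᵐ[halfLine] fun x => Real.exp (-x / δ μ))
    {x : Sobolev (m + 1) × Sobolev (m + 2)} (hx : PositiveDepth ε x.1.fn) {f₀ : ℝ} (f₂ : ℝ)
    (hf₀ : 1 + ε * f₀ ≠ 0) :
    -traceL (dxL (evolution ε μ f₀ f₂ N e x).2) - f₂ =
      -((μ / 3)⁻¹ * (1 + ε / 2 * (f₀ + traceL x.1) -
        ε ^ 2 * traceL x.2 ^ 2 * ((1 + ε * f₀)⁻¹ * (1 + ε * traceL x.1)⁻¹))) *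
        (traceL x.1 - f₀) := by
  have hδ : δ μ ^ 2 = μ / 3 := Real.sq_sqrt (by positivity)
  have hδ0 : δ μ ≠ 0 := (Real.sqrt_pos.2 (by positivity)).ne'
  have hr := traceL_recip hx
  have hr' : 1 + traceL (recip ε x.1) = (1 + ε * traceL x.1)⁻¹ := eq_inv_of_mul_eq_one_right hr
  unfold evolution
  simp only [map_add, map_neg, map_smul, smul_eq_mul]
  rw [traceL_dx_exp he, traceL_dx_dx_neumann hμ hN, traceL_fluxS, ← hr', ← hδ]
  generalize traceL (N (fluxS ε x)) = R
  generalize traceL x.1 = z at *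
  generalize traceL x.2 = q
  generalize traceL (recip ε x.1) = r at *
  generalize δ μ = d at *
  field_simp
  linear_combination (-2 * ε * q ^ 2) * hr

end Sobolev

open Sobolev in
/-- The boundary condition `ζ(t, 0) = f(t)` persists: `y = (ζ(t, 0) - f, -∂ₓq(t, 0) - ḟ)` solves a
linear system `ẏ = (y₂, -k(t) y₁)` with `y(0) = 0`. -/
theorem IsSolution.trace_eq {m : ℕ} {ε μ : ℝ} (hε : ε ≠ 0) (hμ : 0 < μ) {f : ℝ → ℝ}
    (hf : ContDiffOn ℝ 2 f (Ici 0)) {ζ0 : Sobolev (m + 1)} {q0 : Sobolev (m + 2)} {T : ℝ}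
    {ζ : ℝ → Sobolev (m + 1)} {q : ℝ → Sobolev (m + 2)}
    (h : IsSolution ε μ f ζ0 q0 T ζ q) (h0 : trace ζ0.fn = f 0)
    (h1 : -trace q0.dx.fn = derivWithin f (Ici 0) 0) {t : ℝ} (ht : t ∈ Icc 0 T) :
    trace (ζ t).fn = f t := by
  obtain ⟨N, hN⟩ := exists_neumann hμ (m + 1)
  obtain ⟨e, he⟩ := exists_exp (m + 2) (Real.sqrt_pos.2 (by positivity : 0 < μ / 3))
  have hN : IsNeumannOp μ N := hN
  have he : e.fn =ᵐ[halfLine] fun x => Real.exp (-x / δ μ) := he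
  have hα := fun t ht => h.hasDerivWithinAt hε hN he (t := t) ht
  have hsub : Icc 0 T ⊆ Ici 0 := Icc_subset_Ici_self
  have huI := uniqueDiffOn_Ici (0 : ℝ)
  have hit1 : iteratedDerivWithin 1 f (Ici 0) = derivWithin f (Ici 0) := iteratedDerivWithin_one
  have hf1 : ∀ t ∈ Icc 0 T,
      HasDerivWithinAt f (derivWithin f (Ici 0) t) (Icc 0 T) t := fun t ht =>
    ((hf.differentiableOn two_ne_zero t (hsub ht)).hasDerivWithinAt).mono hsub
  have hf2 : ∀ t ∈ Icc 0 T, HasDerivWithinAt (derivWithin f (Ici 0))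
      (iteratedDerivWithin 2 f (Ici 0) t) (Icc 0 T) t := fun t ht => by
    rw [iteratedDerivWithin_succ, hit1]
    have hd : DifferentiableOn ℝ (derivWithin f (Ici 0)) (Ici 0) := by
      rw [← hit1]
      exact hf.differentiableOn_iteratedDerivWithin (by norm_num) huI
    exact ((hd t (hsub ht)).hasDerivWithinAt).mono hsub
  have hcζ : ContinuousOn (fun t => traceL (ζ t)) (Icc 0 T) :=
    traceL.continuous.comp_continuousOn h.contDiff_ζ.continuousOn
  have hcq : ContinuousOn (fun t => traceL (q t)) (Icc 0 T) :=
    traceL.continuous.comp_continuousOn h.contDiff_q.continuousOn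
  have hcf : ContinuousOn f (Icc 0 T) := hf.continuousOn.mono hsub
  let y : ℝ → ℝ × ℝ := fun t =>
    (traceL (ζ t) - f t, -traceL (dxL (q t)) - derivWithin f (Ici 0) t)
  let k : ℝ → ℝ := fun t => (μ / 3)⁻¹ * (1 + ε / 2 * (f t + traceL (ζ t)) -
        ε ^ 2 * traceL (q t) ^ 2 * ((1 + ε * f t)⁻¹ * (1 + ε * traceL (ζ t))⁻¹))
  have hk : ContinuousOn k (Icc 0 T) := by
    have i1 : ContinuousOn (fun t => (1 + ε * f t)⁻¹) (Icc 0 T) :=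
      (continuousOn_const.add (continuousOn_const.mul hcf)).inv₀ h.depth_bdry
    have i2 : ContinuousOn (fun t => (1 + ε * traceL (ζ t))⁻¹) (Icc 0 T) :=
      (continuousOn_const.add (continuousOn_const.mul hcζ)).inv₀ fun t ht =>
        left_ne_zero_of_mul_eq_one (traceL_recip (h.depth t ht))
    exact continuousOn_const.mul ((continuousOn_const.add
      (continuousOn_const.mul (hcf.add hcζ))).sub
      ((continuousOn_const.mul (hcq.pow 2)).mul (i1.mul i2)))
  obtain ⟨M, hM⟩ := isCompact_Icc.exists_bound_of_continuousOn hk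
  have hy : ∀ t ∈ Icc 0 T, HasDerivWithinAt y ((y t).2, -k t * (y t).1) (Icc 0 T) t := by
    intro t ht
    have hζ' := hasDerivWithinAt_fst (hα t ht)
    have hq' := hasDerivWithinAt_snd (hα t ht)
    have a1 := (traceL.hasFDerivAt.comp_hasDerivWithinAt t hζ').sub (hf1 t ht)
    have a2 := (((traceL ∘L dxL).hasFDerivAt.comp_hasDerivWithinAt t hq').neg).sub (hf2 t ht)
    have e1 : traceL (-dxL (q t)) - derivWithin f (Ici 0) t = (y t).2 := by
      rw [map_neg]
    have e2 := traceL_dx_evolution hμ hN he (x := (ζ t, q t)) (h.depth t ht)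
      (iteratedDerivWithin 2 f (Ici 0) t) (h.depth_bdry t ht)
    have a3 := a1.prodMk a2
    refine a3.congr_deriv (Prod.ext e1 e2)
  have hy0 : y 0 = 0 := by
    rw [trace_eq_traceL] at h0
    have h1' : -traceL (dxL q0) = derivWithin f (Ici 0) 0 := by
      rw [← h1, trace_eq_traceL, dxL_apply]
    refine Prod.ext ?_ ?_
    · change traceL (ζ 0) - f 0 = 0
      rw [h.init_ζ, h0, sub_self]
    · change -traceL (dxL (q 0)) - derivWithin f (Ici 0) 0 = 0
      rw [h.init_q, h1', sub_self]
  have key := eq_zero_of_abs_deriv_le_mul_abs_self_of_eq_zero_right (f := y) (K := max 1 M)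
    (fun t ht => (hy t ht).continuousWithinAt)
    (fun t ht => (hy t (Ico_subset_Icc_self ht)).mono_of_mem_nhdsWithin
      (mem_of_superset (Icc_mem_nhdsGE ht.2) (Icc_subset_Icc_left ht.1))) hy0
    (fun t ht => by
      refine max_le ?_ ?_
      · exact (norm_snd_le (y t)).trans (le_mul_of_one_le_left (norm_nonneg _) (le_max_left _ _))
      · change ‖-k t * (y t).1‖ ≤ _
        rw [norm_mul, norm_neg]
        exact mul_le_mul ((hM t (Ico_subset_Icc_self ht)).trans (le_max_right _ _))
          (norm_fst_le _) (norm_nonneg _) (by positivity)) t ht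
  rw [trace_eq_traceL]
  exact sub_eq_zero.1 (congrArg Prod.fst key)

end

end AbbottBoussinesq

open AbbottBoussinesq AbbottBoussinesq.Sobolev in
theorem mainTheorem1 (ε μ : ℝ) (hε : 0 < ε) (hμ : 0 < μ)
    (f : ℝ → ℝ) (hf : ContDiffOn ℝ 2 f (Ici 0)) (hf0 : 1 + ε * f 0 ≠ 0)
    (n : ℕ) (hn : 1 ≤ n)
    (ζ0 : AbbottBoussinesq.Sobolev n) (q0 : AbbottBoussinesq.Sobolev (n + 1))
    (hζ0 : AbbottBoussinesq.PositiveDepth ε ζ0.fn) :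
    ∃ T : ℝ, 0 < T ∧
      ∃ (ζ : ℝ → AbbottBoussinesq.Sobolev n) (q : ℝ → AbbottBoussinesq.Sobolev (n + 1)),
        AbbottBoussinesq.IsSolution ε μ f ζ0 q0 T ζ q ∧
        (∀ (ζ' : ℝ → AbbottBoussinesq.Sobolev n) (q' : ℝ → AbbottBoussinesq.Sobolev (n + 1)),
          AbbottBoussinesq.IsSolution ε μ f ζ0 q0 T ζ' q' →
            EqOn ζ' ζ (Icc 0 T) ∧ EqOn q' q (Icc 0 T)) ∧
        (AbbottBoussinesq.trace ζ0.fn = f 0 →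
          -AbbottBoussinesq.trace q0.dx.fn = derivWithin f (Ici 0) 0 →
            ∀ t ∈ Icc 0 T, AbbottBoussinesq.trace (ζ t).fn = f t) := by
  obtain ⟨m, rfl⟩ : ∃ m, n = m + 1 := ⟨n - 1, by omega⟩
  obtain ⟨N, hN⟩ := exists_neumann hμ (m + 1)
  obtain ⟨e, he⟩ := exists_exp (m + 2) (Real.sqrt_pos.2 (by positivity : 0 < μ / 3))
  have hN : IsNeumannOp μ N := hN
  have he : e.fn =ᵐ[halfLine] fun x => Real.exp (-x / δ μ) := he
  -- a time interval on which `1 + ε f` does not vanish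
  obtain ⟨τ, hτ, hτf⟩ : ∃ τ, 0 < τ ∧ ∀ t ∈ Icc 0 τ, 1 + ε * f t ≠ 0 := by
    have hc : ContinuousWithinAt (fun t => 1 + ε * f t) (Ici 0) 0 :=
      continuousWithinAt_const.add (continuousWithinAt_const.mul (hf.continuousOn 0 self_mem_Ici))
    obtain ⟨d, hd, h⟩ := mem_nhdsGE_iff_exists_Icc_subset.1 (hc.eventually_ne hf0)
    exact ⟨d, hd, h⟩
  have hsub : Icc 0 τ ⊆ Ici 0 := Icc_subset_Ici_self
  have hcf : ContinuousOn f (Icc 0 τ) := hf.continuousOn.mono hsub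
  have hcf2 : ContinuousOn (iteratedDerivWithin 2 f (Ici 0)) (Icc 0 τ) :=
    (hf.continuousOn_iteratedDerivWithin le_rfl (uniqueDiffOn_Ici 0)).mono hsub
  have hU : IsOpen {x : Sobolev (m + 1) × Sobolev (m + 2) | PositiveDepth ε x.1.fn} :=
    (isOpen_positiveDepth ε).preimage continuous_fst
  have hV := fun (x : Sobolev (m + 1) × Sobolev (m + 2))
      (hx : x ∈ {x : Sobolev (m + 1) × Sobolev (m + 2) | PositiveDepth ε x.1.fn}) =>
    exists_lipschitzOnWith_evolution (μ := μ) (N := N) (e := e)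
      (f₂ := iteratedDerivWithin 2 f (Ici 0)) hcf hτf hx
  obtain ⟨T, hT, hTτ, α, hα0, hα⟩ := exists_solution_of_locallyLipschitz
    (V := fun t => evolution ε μ (f t) (iteratedDerivWithin 2 f (Ici 0) t) N e) hU hτ hV
    (fun x hx => continuousOn_evolution hcf hcf2 hτf continuousOn_const fun _ _ => hx)
    (x₀ := (ζ0, q0)) hζ0
  have hTs : Icc 0 T ⊆ Icc 0 τ := Icc_subset_Icc_right hTτ
  have hsol := isSolution_of_hasDerivWithinAt hT hε.ne' hN he hf (fun t ht => hτf t (hTs ht)) hα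
  rw [hα0] at hsol
  refine ⟨T, hT, _, _, hsol, fun ζ' q' h' => ?_, fun h0 h1 t ht =>
    hsol.trace_eq hε.ne' hμ hf h0 h1 ht⟩
  have heq := eqOn_of_locallyLipschitz (α := α) (β := fun t => (ζ' t, q' t))
    (V := fun t => evolution ε μ (f t) (iteratedDerivWithin 2 f (Ici 0) t) N e)
    (U := {x : Sobolev (m + 1) × Sobolev (m + 2) | PositiveDepth ε x.1.fn})
    (fun x hx => by
      obtain ⟨K, s, hs, hK⟩ := hV x hx
      exact ⟨K, s, hs, fun t ht => hK t (hTs ht)⟩)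
    (by rw [hα0, h'.init_ζ, h'.init_q]) hα
    (fun t ht => h'.hasDerivWithinAt hε.ne' hN he ht)
  exact ⟨fun t ht => (congrArg Prod.fst (heq ht)).symm,
    fun t ht => (congrArg Prod.snd (heq ht)).symm⟩
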